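/- **Quartic Jacobi symbol.** For a prime $\pi$ of $\mathbb Z[i]$ with $\pi\nmid 2$ and $\alpha\in\mathbb Z[i]$, let $\left(\frac{\alpha}{\pi}\right)_4=0$ if $\pi\mid\alpha$, and otherwise let it be the unique $u\in\{1,i,-1,-i\}$ with $\alpha^{(N\pi-1)/4}\equiv u\pmod \pi$. For $\beta\in\mathbb Z[i]$ of odd norm with $\beta=\varepsilon\pi_1\cdots\pi_r$ ($\varepsilon$ a unit, $\pi_j$ prime), put $\left(\frac{\alpha}{\beta}\right)_4=\prod_j\left(\frac{\alpha}{\pi_j}\right)_4$, and for a nonzero integer $D$ prime to $\beta$ put $\left(\frac{\alpha/D}{\beta}\right)_4=\left(\frac{\alpha}{\beta}\right)_4\left(\frac{D}{\beta}\right)_4^{-1}$. **Theorem 3.1.** Let $p\equiv 1\pmod 4$ be a prime and let $q\in\mathbb Z$ satisfy $q\equiv 3\pmod 8$ and $p\nmid q$. Suppose that $p=c^2+d^2$ and $4p=x^2+qy^2$ with $c,d,x,y\in\mathbb Z$, $c\equiv y\equiv 1\pmod 4$ and $\gcd(c,x+2d)=1$, and let $k\in\mathbb Z$ be such that $$\left(\frac{\frac{2c}{x+2d}+i}{q}\right)_4=i^k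 .$$ Then $$(-q)^{[p/8]}\equiv\begin{cases}(-1)^{[\frac x4]+\frac{q-3}8}\left(\dfrac dc\right)^{k-1}\pmod p&\text{if } p\equiv 1\pmod 8,\\[2mm] -(-1)^{\frac{x^2-1}8+\frac{q-3}8}\left(\dfrac dc\right)^{k-1}\dfrac yx\pmod p&\text{if } p\equiv 5\pmod 8,\end{cases}$$ where $[\cdot]$ is the greatest integer function and the fractions are read modulo $p$ ($c,d,x$ are prime to $p$). -/

import Mathlib

open Classical in
/-- The quartic residue symbol of `α` modulo a Gaussian prime `π` not dividing `2`:
it is `0` if `π ∣ α`, and otherwise the unique `u ∈ {1, i, -1, -i}` with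
`α ^ ((N π - 1) / 4) ≡ u (mod π)`. -/
noncomputable def quarticResidueSymbol (α π : GaussianInt) : GaussianInt :=
  let n : ℕ := (π.norm.natAbs - 1) / 4
  let i : GaussianInt := ⟨0, 1⟩
  if π ∣ α then 0
  else if π ∣ α ^ n - 1 then 1
  else if π ∣ α ^ n - i then i
  else if π ∣ α ^ n - (-1) then -1
  else if π ∣ α ^ n - (-i) then -i
  else 0

/-- The quartic Jacobi symbol of `α` modulo `β`, for a Gaussian integer `β` of odd norm: the product
of the quartic residue symbols of `α` modulo the prime factors of `β`, with multiplicity.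
The residue symbol modulo `π` does not change when `π` is replaced by an associate, so neither the
choice of the prime factors nor a unit factor of `β` matters. The symbol is `1` if `β` is a unit. -/
noncomputable def quarticJacobiSymbol (α β : GaussianInt) : GaussianInt :=
  ((UniqueFactorizationMonoid.factors β).map (quarticResidueSymbol α)).prod

/-- The quartic Jacobi symbol of `a + b i` modulo `β`, for `β` of odd norm and rational numbers
`a`, `b` whose denominators are prime to `β`. With the common denominator `D` of `a` and `b`, it is
the symbol of the Gaussian integer `D (a + b i)` divided by the symbol of `D`; the latter is one of
`1, i, -1, -i`, so its inverse is its conjugate. -/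
noncomputable def quarticJacobiSymbolRat (a b : ℚ) (β : GaussianInt) : GaussianInt :=
  quarticJacobiSymbol ⟨a.num * b.den, b.num * a.den⟩ β *
    star (quarticJacobiSymbol ((a.den * b.den : ℕ) : GaussianInt) β)

/-! Put `π = c + di`. Sending `i` to `d/c` identifies `ℤ[i]/π` with `ZMod p`, where `-q = (x/y)²`.
So `(-q)^[p/8]` is `(x/π)₄ (y/π)₄⁻¹`, with a further factor `y/x` if `p ≡ 5 (mod 8)`, and it
suffices to show that `(x/π)₄ · i` is, up to an explicit sign, the given symbol times `(y/π)₄`.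

The bridge is `λ = A - 2ci` with `A = x + 2d`. Since `iλ = 2c + Ai`, the given symbol is `-(λ/q)₄`.
Moreover `λ ≡ -2iπ (mod x)` and `λ² ≡ -4iAπ (mod y)`, while `Nλ = 2xA + qy²` yields `-qy² ≡ 2xA (mod
λ)`. The factor `2` is removed by `B = A + 2c`, because `iB² ≡ 2A² (mod λ)`. Symbols modulo `λ` are
inverted by reciprocity, rational integers have trivial symbol modulo coprime odd rational integers,
and `(i/n)₄` depends on `n` modulo 8. This gives `symbol_relation_explicit`; residues modulo 8 and
16 settle the signs.

The reciprocity law `quarticJacobiSymbol_reciprocity`, between a rational and a Gaussian integer,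
comes from the Gauss sum `g` of the quartic character modulo a prime `π` with even imaginary part.
There `g⁴ = π³ π̄`, and comparing this with the action of Frobenius on `g` in characteristic `l`
relates the symbols of `π` modulo `l` and of `l` modulo `π`. -/

namespace GaussianInt

/-- The imaginary unit of `ℤ[i]`. -/
abbrev I : GaussianInt := ⟨0, 1⟩

/-! ### Fourth roots of unity and odd norms. -/

theorem I_mul_I : I * I = -1 := by decide

theorem I_pow_four : I ^ 4 = 1 := by decide

theorem pow_four_eq_one_iff {s : GaussianInt} : s ^ 4 = 1 ↔ s = 1 ∨ s = I ∨ s = -1 ∨ s = -I := by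
  constructor
  · intro h
    have : (s - 1) * ((s - I) * ((s - -1) * (s - -I))) = 0 := by
      linear_combination h + (s ^ 2 - 1) * (-1 : GaussianInt) * I_mul_I
    simpa only [mul_eq_zero, sub_eq_zero] using this
  · rintro (rfl | rfl | rfl | rfl) <;> decide

theorem star_mul_self_of_pow_four {s : GaussianInt} (h : s ^ 4 = 1) : star s * s = 1 := by
  rcases pow_four_eq_one_iff.1 h with rfl | rfl | rfl | rfl <;> decide

theorem star_eq_cube_of_pow_four {s : GaussianInt} (h : s ^ 4 = 1) : star s = s ^ 3 := by
  rcases pow_four_eq_one_iff.1 h with rfl | rfl | rfl | rfl <;> decide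

theorem norm_dvd_norm {a b : GaussianInt} (h : a ∣ b) : a.norm ∣ b.norm := by
  obtain ⟨c, rfl⟩ := h
  exact ⟨c.norm, Zsqrtd.norm_mul _ _⟩

theorem norm_eq_sq_add_sq (a : GaussianInt) : a.norm = a.re ^ 2 + a.im ^ 2 := by
  rw [Zsqrtd.norm_def]; ring

theorem ne_zero_of_norm_odd {a : GaussianInt} (h : Odd a.norm) : a ≠ 0 := by
  rintro rfl
  simp at h

theorem norm_mod_four {a : GaussianInt} (h : Odd a.norm) : a.norm % 4 = 1 := by
  rw [Int.odd_iff] at h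
  rw [norm_eq_sq_add_sq] at *
  have key (x : ℤ) : x ^ 2 % 4 = 0 ∨ x ^ 2 % 4 = 1 := by
    obtain ⟨y, rfl | rfl⟩ := Int.even_or_odd' x
    · left; rw [show (2 * y) ^ 2 = 4 * (y * y) by ring]; omega
    · right; rw [show (2 * y + 1) ^ 2 = 4 * (y * y + y) + 1 by ring]; omega
  have h1 := key a.re
  have h2 := key a.im
  omega

theorem isUnit_of_dvd_of_dvd_two_pow {a b : GaussianInt} (ha : Odd a.norm) {n : ℕ}
    (hb : b.norm = 2 ^ n) (h : a ∣ b) : IsUnit a := by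
  have h1 := norm_dvd_norm h
  rw [hb] at h1
  have h2 : IsCoprime a.norm (2 ^ n) :=
    IsCoprime.pow_right (Int.isCoprime_iff_gcd_eq_one.2 (by
      rw [Int.gcd_comm]; exact Int.isCoprime_iff_gcd_eq_one.1 (Int.isCoprime_two_left.2 ha)))
  rw [Zsqrtd.isUnit_iff_norm_isUnit]
  exact h2.isUnit_of_dvd' dvd_rfl h1

/-- Distinct fourth roots of unity differ by an element of norm 2 or 4, which no prime of odd norm
divides. Congruences between symbols thereby become equalities. -/
theorem eq_of_dvd_sub_of_pow_four {π s t : GaussianInt} (hπ : Prime π) (hodd : Odd π.norm)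
    (hs : s ^ 4 = 1) (ht : t ^ 4 = 1) (h : π ∣ s - t) : s = t := by
  by_contra hne
  refine hπ.not_isUnit ?_
  have : (s - t).norm = 2 ^ 1 ∨ (s - t).norm = 2 ^ 2 := by
    rcases pow_four_eq_one_iff.1 hs with rfl | rfl | rfl | rfl <;>
      rcases pow_four_eq_one_iff.1 ht with rfl | rfl | rfl | rfl <;> revert hne <;> decide
  rcases this with h1 | h1 <;> exact isUnit_of_dvd_of_dvd_two_pow hodd h1 h

/-! ### Residue fields of Gaussian primes. -/

/-- A realization of `ℤ[i]/(π)` as a finite field with `N π` elements. -/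
structure IsResidueField (π : GaussianInt) (F : Type) [Field F] [Fintype F]
    (φ : GaussianInt →+* F) : Prop where
  surjective : Function.Surjective φ
  map_eq_zero_iff : ∀ α, φ α = 0 ↔ π ∣ α
  card : Fintype.card F = π.norm.natAbs

/-- The coordinates of a Gaussian integer. -/
def coordEquiv : GaussianInt ≃ₗ[ℤ] (Fin 2 → ℤ) where
  toFun a := ![a.re, a.im]
  invFun v := ⟨v 0, v 1⟩
  map_add' a b := by ext i; fin_cases i <;> simp
  map_smul' a b := by ext i; fin_cases i <;> simp
  left_inv a := by simp
  right_inv v := by ext i; fin_cases i <;> simp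

/-- The basis `1, i` of `ℤ[i]`. -/
noncomputable def basisOneI : Module.Basis (Fin 2) ℤ GaussianInt := .ofEquivFun coordEquiv

theorem algebraNorm_eq (a : GaussianInt) : Algebra.norm ℤ a = a.norm := by
  rw [Algebra.norm_eq_matrix_det basisOneI, Matrix.det_fin_two]
  simp [Algebra.leftMulMatrix_eq_repr_mul, basisOneI, coordEquiv, Zsqrtd.norm_def]

theorem card_quotient_span {π : GaussianInt} :
    Nat.card (GaussianInt ⧸ Ideal.span {π}) = π.norm.natAbs := by
  have : Module.Free ℤ GaussianInt := .of_basis basisOneI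
  have : Module.Finite ℤ GaussianInt := .of_basis basisOneI
  rw [← algebraNorm_eq, ← Ideal.absNorm_span_singleton, Ideal.absNorm_apply,
    Submodule.cardQuot_apply]

theorem exists_isResidueField {π : GaussianInt} (hπ : Prime π) :
    ∃ (F : Type) (_ : Field F) (_ : Fintype F) (φ : GaussianInt →+* F), IsResidueField π F φ := by
  have hmax : (Ideal.span {π}).IsMaximal :=
    PrincipalIdealRing.isMaximal_of_irreducible hπ.irreducible
  let := Ideal.Quotient.field (Ideal.span {π})
  have : Finite (GaussianInt ⧸ Ideal.span {π}) := by
    refine Nat.finite_of_card_ne_zero ?_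
    rw [card_quotient_span, Int.natAbs_ne_zero, Ne, norm_eq_zero]
    exact hπ.ne_zero
  let := Fintype.ofFinite (GaussianInt ⧸ Ideal.span {π})
  refine ⟨_, inferInstance, inferInstance, Ideal.Quotient.mk (Ideal.span {π}),
    Ideal.Quotient.mk_surjective, fun α => ?_, ?_⟩
  · rw [Ideal.Quotient.eq_zero_iff_mem, Ideal.mem_span_singleton]
  · rw [← Nat.card_eq_fintype_card, card_quotient_span]

theorem IsResidueField.map_eq_iff {π : GaussianInt} {F : Type} [Field F] [Fintype F]
    {φ : GaussianInt →+* F} (h : IsResidueField π F φ) {α β : GaussianInt} :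
    φ α = φ β ↔ π ∣ α - β := by
  rw [← h.map_eq_zero_iff, map_sub, sub_eq_zero]

theorem natAbs_norm_eq_four_mul {a : GaussianInt} (h : Odd a.norm) :
    a.norm.natAbs = 4 * ((a.norm.natAbs - 1) / 4) + 1 := by
  have := norm_mod_four h
  have := GaussianInt.norm_nonneg a
  omega

end GaussianInt

/-! ### The quartic residue symbol modulo a prime. -/

open GaussianInt

theorem quarticResidueSymbol_eq_zero {α π : GaussianInt} (h : π ∣ α) :
    quarticResidueSymbol α π = 0 := by
  simp [quarticResidueSymbol, h]

theorem quarticResidueSymbol_spec {α π : GaussianInt} (hπ : Prime π) (hodd : Odd π.norm)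
    (h : ¬ π ∣ α) : quarticResidueSymbol α π ^ 4 = 1 ∧
      π ∣ α ^ ((π.norm.natAbs - 1) / 4) - quarticResidueSymbol α π := by
  obtain ⟨F, _, _, φ, hF⟩ := exists_isResidueField hπ
  set n := (π.norm.natAbs - 1) / 4 with hn
  have hα : φ α ≠ 0 := by rwa [Ne, hF.map_eq_zero_iff]
  have h1 : φ α ^ (4 * n) = 1 := by
    rw [← FiniteField.pow_card_sub_one_eq_one _ hα, hF.card]
    congr 1
    have := natAbs_norm_eq_four_mul hodd
    omega
  have h2 : π ∣ (α ^ n - 1) * ((α ^ n - I) * ((α ^ n - -1) * (α ^ n - -I))) := by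
    rw [← hF.map_eq_zero_iff]
    have h3 : (α ^ n - 1) * ((α ^ n - I) * ((α ^ n - -1) * (α ^ n - -I))) = α ^ (4 * n) - 1 := by
      rw [mul_comm 4 n, pow_mul]
      generalize α ^ n = s
      linear_combination (1 - s ^ 2) * I_mul_I
    rw [h3, map_sub, map_pow, h1, map_one, sub_self]
  have h4 := (hπ.dvd_or_dvd h2).imp_right fun h => (hπ.dvd_or_dvd h).imp_right hπ.dvd_or_dvd
  simp only [quarticResidueSymbol, if_neg h, ← hn]
  split_ifs with h5 h6 h7 h8
  · exact ⟨by decide, h5⟩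
  · exact ⟨by decide, h6⟩
  · exact ⟨by decide, h7⟩
  · exact ⟨by decide, h8⟩
  · exact absurd h4 (by simp only [not_or]; exact ⟨h5, h6, h7, h8⟩)

theorem quarticResidueSymbol_pow_four {α π : GaussianInt} (hπ : Prime π) (hodd : Odd π.norm)
    (h : ¬ π ∣ α) : quarticResidueSymbol α π ^ 4 = 1 := (quarticResidueSymbol_spec hπ hodd h).1

/-- No hypothesis `¬ π ∣ α` is needed: the exponent is positive, so `π ∣ α` would make `π` divide
the unit `s`. -/
theorem quarticResidueSymbol_eq_of_dvd {α π s : GaussianInt} (hπ : Prime π) (hodd : Odd π.norm)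
    (hs : s ^ 4 = 1) (h : π ∣ α ^ ((π.norm.natAbs - 1) / 4) - s) :
    quarticResidueSymbol α π = s := by
  have hα : ¬ π ∣ α := by
    intro hα
    have hn : (π.norm.natAbs - 1) / 4 ≠ 0 := by
      intro h0
      have h1 := natAbs_norm_eq_four_mul hodd
      rw [h0] at h1
      exact hπ.not_isUnit (Zsqrtd.norm_eq_one_iff.1 h1)
    have h2 : π ∣ s := by
      have := dvd_sub (dvd_pow hα hn) h
      rwa [sub_sub_cancel] at this
    exact hπ.not_isUnit (isUnit_of_dvd_unit (h2.trans (dvd_pow_self s four_ne_zero)) (by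
      rw [hs]; exact isUnit_one))
  have h1 := quarticResidueSymbol_spec hπ hodd hα
  refine eq_of_dvd_sub_of_pow_four hπ hodd h1.1 hs ?_
  have := dvd_sub h h1.2
  rwa [sub_sub_sub_cancel_left] at this

theorem quarticResidueSymbol_mul {π : GaussianInt} (hπ : Prime π) (hodd : Odd π.norm)
    (α β : GaussianInt) : quarticResidueSymbol (α * β) π =
      quarticResidueSymbol α π * quarticResidueSymbol β π := by
  by_cases hα : π ∣ α
  · rw [quarticResidueSymbol_eq_zero hα, zero_mul,
      quarticResidueSymbol_eq_zero (hα.mul_right _)]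
  by_cases hβ : π ∣ β
  · rw [quarticResidueSymbol_eq_zero hβ, mul_zero, quarticResidueSymbol_eq_zero (hβ.mul_left _)]
  have h1 := quarticResidueSymbol_spec hπ hodd hα
  have h2 := quarticResidueSymbol_spec hπ hodd hβ
  refine quarticResidueSymbol_eq_of_dvd hπ hodd (by rw [mul_pow, h1.1, h2.1, one_mul]) ?_
  rw [mul_pow]
  exact (dvd_mul_sub_mul h1.2 h2.2)

theorem quarticResidueSymbol_congr {π α β : GaussianInt} (hπ : Prime π) (hodd : Odd π.norm)
    (h : π ∣ α - β) : quarticResidueSymbol α π = quarticResidueSymbol β π := by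
  by_cases hβ : π ∣ β
  · rw [quarticResidueSymbol_eq_zero hβ, quarticResidueSymbol_eq_zero ((dvd_iff_dvd_of_dvd_sub h).2 hβ)]
  have h1 := quarticResidueSymbol_spec hπ hodd hβ
  refine quarticResidueSymbol_eq_of_dvd hπ hodd h1.1 ?_
  have := dvd_add (h.trans (sub_dvd_pow_sub_pow α β ((π.norm.natAbs - 1) / 4))) h1.2
  rwa [sub_add_sub_cancel] at this

theorem quarticResidueSymbol_associated {π ρ : GaussianInt} (h : Associated π ρ)
    (α : GaussianInt) : quarticResidueSymbol α π = quarticResidueSymbol α ρ := by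
  have hn : π.norm = ρ.norm := Zsqrtd.norm_eq_of_associated (by norm_num) h
  have hd (x : GaussianInt) : π ∣ x ↔ ρ ∣ x := h.dvd_iff_dvd_left
  classical
  unfold quarticResidueSymbol
  rw [hn]
  exact if_congr (hd _) rfl (if_congr (hd _) rfl (if_congr (hd _) rfl (if_congr (hd _) rfl
    (if_congr (hd _) rfl rfl))))

theorem quarticResidueSymbol_star {π : GaussianInt} (hπ : Prime π) (hodd : Odd π.norm)
    (α : GaussianInt) :
    quarticResidueSymbol (star α) (star π) = star (quarticResidueSymbol α π) := by
  have hdvd {a b : GaussianInt} (h : a ∣ b) : star a ∣ star b := map_dvd (starRingEnd GaussianInt) h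
  have hπ' : Prime (star π) := (MulEquiv.prime_iff (starRingAut (R := GaussianInt))).2 (by simpa using hπ)
  by_cases hα : π ∣ α
  · rw [quarticResidueSymbol_eq_zero hα, quarticResidueSymbol_eq_zero (hdvd hα), star_zero]
  have h1 := quarticResidueSymbol_spec hπ hodd hα
  refine quarticResidueSymbol_eq_of_dvd hπ' (by rwa [Zsqrtd.norm_conj]) ?_ ?_
  · rw [← star_pow, h1.1, star_one]
  · rw [Zsqrtd.norm_conj, ← star_pow, ← star_sub]
    exact hdvd h1.2

/-! ### The quartic character, its Jacobi sum and its Gauss sum. -/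

namespace GaussianInt.IsResidueField

variable {π : GaussianInt} {F : Type} [Field F] [Fintype F] {φ : GaussianInt →+* F}

theorem map_pow_eq_map_symbol (hF : IsResidueField π F φ) (hπ : Prime π) (hodd : Odd π.norm)
    (α : GaussianInt) : φ α ^ ((π.norm.natAbs - 1) / 4) = φ (quarticResidueSymbol α π) := by
  by_cases h : π ∣ α
  · have hn : (π.norm.natAbs - 1) / 4 ≠ 0 := by
      intro h0
      have h1 := natAbs_norm_eq_four_mul hodd
      rw [h0] at h1
      exact hπ.not_isUnit (Zsqrtd.norm_eq_one_iff.1 h1)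
    rw [quarticResidueSymbol_eq_zero h, (hF.map_eq_zero_iff α).2 h, map_zero, zero_pow hn]
  · rw [← map_pow, hF.map_eq_iff]
    exact (quarticResidueSymbol_spec hπ hodd h).2

/-- The quartic residue symbol modulo `π` as a multiplicative character of `ℤ[i]/(π)`. -/
noncomputable def quarticChar (hF : IsResidueField π F φ) (hπ : Prime π) (hodd : Odd π.norm) :
    MulChar F GaussianInt where
  toFun a := quarticResidueSymbol (Function.surjInv hF.surjective a) π
  map_one' := by
    refine quarticResidueSymbol_eq_of_dvd hπ hodd (one_pow 4) ?_
    rw [← hF.map_eq_iff, map_pow, Function.surjInv_eq hF.surjective, one_pow, map_one]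
  map_mul' a b := by
    rw [← quarticResidueSymbol_mul hπ hodd]
    refine quarticResidueSymbol_congr hπ hodd ?_
    rw [← hF.map_eq_iff, map_mul, Function.surjInv_eq hF.surjective, Function.surjInv_eq hF.surjective,
      Function.surjInv_eq hF.surjective]
  map_nonunit' a ha := by
    refine quarticResidueSymbol_eq_zero ?_
    rw [← hF.map_eq_zero_iff, Function.surjInv_eq hF.surjective]
    simpa using ha

variable (hF : IsResidueField π F φ) (hπ : Prime π) (hodd : Odd π.norm)

theorem quarticChar_apply (α : GaussianInt) :
    hF.quarticChar hπ hodd (φ α) = quarticResidueSymbol α π := by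
  refine quarticResidueSymbol_congr hπ hodd ?_
  rw [← hF.map_eq_iff, Function.surjInv_eq hF.surjective]

theorem map_quarticChar (a : F) :
    φ (hF.quarticChar hπ hodd a) = a ^ ((π.norm.natAbs - 1) / 4) := by
  obtain ⟨α, rfl⟩ := hF.surjective a
  rw [quarticChar_apply, hF.map_pow_eq_map_symbol hπ hodd]

theorem quarticChar_apply_pow_four {a : F} (ha : a ≠ 0) : hF.quarticChar hπ hodd a ^ 4 = 1 := by
  obtain ⟨α, rfl⟩ := hF.surjective a
  rw [quarticChar_apply]
  exact quarticResidueSymbol_pow_four hπ hodd (by rwa [← hF.map_eq_zero_iff])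

theorem quarticChar_pow_four : hF.quarticChar hπ hodd ^ 4 = 1 := by
  refine MulChar.ext fun a => ?_
  rw [MulChar.pow_apply_coe, quarticChar_apply_pow_four _ _ _ a.ne_zero, MulChar.one_apply_coe]

include hF in
theorem card_eq (hodd : Odd π.norm) : Fintype.card F = 4 * ((π.norm.natAbs - 1) / 4) + 1 := by
  rw [hF.card]
  exact natAbs_norm_eq_four_mul hodd

include hF in
theorem ringChar_ne_two (hodd : Odd π.norm) : ringChar F ≠ 2 := by
  intro h
  have h1 := FiniteField.even_card_of_char_two h
  have h2 := hF.card_eq hodd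
  omega

/-- By Euler's criterion any nonsquare works, since `χ(a)²` reduces to `a^((Nπ-1)/2)`. This shows
that `χ²` is nontrivial. -/
theorem exists_quarticChar_sq_eq : ∃ a ≠ 0, hF.quarticChar hπ hodd a ^ 2 = -1 := by
  obtain ⟨a, ha⟩ := FiniteField.exists_nonsquare (hF.ringChar_ne_two hodd)
  have ha0 : a ≠ 0 := by
    rintro rfl
    exact ha (IsSquare.zero)
  refine ⟨a, ha0, ?_⟩
  have h4 := hF.quarticChar_apply_pow_four hπ hodd ha0
  have h1 : hF.quarticChar hπ hodd a ^ 2 ≠ 1 := by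
    intro h1
    refine ha ((FiniteField.isSquare_iff (hF.ringChar_ne_two hodd) ha0).2 ?_)
    have h2 := congrArg φ h1
    rw [map_pow, map_quarticChar, map_one, ← pow_mul] at h2
    rw [← h2, hF.card_eq hodd]
    congr 1
    omega
  have h2 : (hF.quarticChar hπ hodd a ^ 2 - 1) * (hF.quarticChar hπ hodd a ^ 2 + 1) = 0 := by
    linear_combination h4
  exact eq_neg_of_add_eq_zero_left ((mul_eq_zero.1 h2).resolve_left (sub_ne_zero.2 h1))

/-- Modulo `π` the Jacobi sum is `∑ xⁿ(1-x)ⁿ` with `n = (Nπ-1)/4`, a polynomial of degree `2n < Nπ -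
1`, and power sums of such exponents vanish. -/
theorem dvd_jacobiSum :
    π ∣ jacobiSum (hF.quarticChar hπ hodd) (hF.quarticChar hπ hodd) := by
  rw [← hF.map_eq_zero_iff, jacobiSum, map_sum]
  simp only [map_mul, map_quarticChar]
  set n := (π.norm.natAbs - 1) / 4 with hn
  have hn0 : n ≠ 0 := by
    intro h0
    have h1 := natAbs_norm_eq_four_mul hodd
    rw [← hn, h0] at h1
    exact hπ.not_isUnit (Zsqrtd.norm_eq_one_iff.1 h1)
  have hexp (x : F) : x ^ n * (1 - x) ^ n =
      ∑ j ∈ Finset.range (n + 1), ((-1) ^ j * (n.choose j : F)) * x ^ (n + j) := by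
    rw [sub_eq_neg_add, add_pow, Finset.mul_sum]
    refine Finset.sum_congr rfl fun j _ => ?_
    rw [neg_pow, one_pow]
    ring
  simp only [hexp]
  rw [Finset.sum_comm]
  refine Finset.sum_eq_zero fun j hj => ?_
  have h1 : ∑ x : F, x ^ (n + j) = 0 := by
    refine FiniteField.sum_pow_lt_card_sub_one F _ ?_
    rw [hF.card_eq hodd]
    have := Finset.mem_range.1 hj
    omega
  rw [← Finset.mul_sum, h1, mul_zero]

section hom

variable {K : Type*} [CommRing K] (θ : GaussianInt →+* K) (h2 : (2 : K) ≠ 0)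

include h2 in
theorem quarticChar_comp_sq_ne_one : (hF.quarticChar hπ hodd).ringHomComp θ ^ 2 ≠ 1 := by
  intro h
  obtain ⟨a, ha, h1⟩ := hF.exists_quarticChar_sq_eq hπ hodd
  have h3 := congrArg (fun χ : MulChar F K => χ (Units.mk0 a ha)) h
  simp only [MulChar.pow_apply_coe, MulChar.one_apply_coe, MulChar.ringHomComp_apply] at h3
  rw [← map_pow, Units.val_mk0, h1, map_neg, map_one] at h3
  apply h2
  linear_combination -h3

include h2 in
theorem quarticChar_comp_ne_one : (hF.quarticChar hπ hodd).ringHomComp θ ≠ 1 := by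
  intro h
  exact hF.quarticChar_comp_sq_ne_one hπ hodd θ h2 (by rw [h, one_pow])

variable [IsDomain K]

theorem quarticChar_comp_sq_isQuadratic :
    ((hF.quarticChar hπ hodd).ringHomComp θ ^ 2).IsQuadratic := by
  intro a
  by_cases ha : a = 0
  · left
    rw [ha, MulChar.map_zero]
  · right
    rw [MulChar.pow_apply' _ two_ne_zero, MulChar.ringHomComp_apply]
    have h := congrArg θ (hF.quarticChar_apply_pow_four hπ hodd ha)
    rw [map_pow, map_one] at h
    have h3 : (θ (hF.quarticChar hπ hodd a) ^ 2 - 1) * (θ (hF.quarticChar hπ hodd a) ^ 2 + 1) = 0 := by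
      linear_combination h
    exact (mul_eq_zero.1 h3).imp sub_eq_zero.1 eq_neg_of_add_eq_zero_left

theorem quarticChar_neg_one_sq : hF.quarticChar hπ hodd (-1) ^ 2 = 1 := by
  rw [← map_pow, neg_one_sq, map_one]

-- With `J = J(χ,χ)`, one has `g(χ)² = J g(χ²)`, and the quadratic Gauss sum satisfies `g(χ²)² =
-- χ²(-1) Nπ = Nπ`.
include h2 in
theorem gaussSum_pow_four {ψ : AddChar F K} (hψ : ψ.IsPrimitive) :
    gaussSum ((hF.quarticChar hπ hodd).ringHomComp θ) ψ ^ 4 =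
      θ (jacobiSum (hF.quarticChar hπ hodd) (hF.quarticChar hπ hodd)) ^ 2 *
        (π.norm.natAbs : K) := by
  set χ := (hF.quarticChar hπ hodd).ringHomComp θ with hχ
  have h3 := jacobiSum_mul_nontrivial (χ := χ) (φ := χ)
    (by rw [← sq]; exact hF.quarticChar_comp_sq_ne_one hπ hodd θ h2) ψ
  have h4 := gaussSum_sq (hF.quarticChar_comp_sq_ne_one hπ hodd θ h2)
    (hF.quarticChar_comp_sq_isQuadratic hπ hodd θ) hψ
  rw [← hχ, MulChar.pow_apply' _ two_ne_zero, hχ, MulChar.ringHomComp_apply, ← map_pow,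
    quarticChar_neg_one_sq, map_one, one_mul, hF.card, ← hχ] at h4
  rw [jacobiSum_ringHomComp, ← sq χ, ← sq (gaussSum χ ψ)] at h3
  rw [show (4 : ℕ) = 2 * 2 from rfl, pow_mul, ← h3, mul_pow, h4, mul_comm]

end hom

/-- Over `ℂ` this is `J(χ,χ) J(χ⁻¹,χ⁻¹) = Nπ`, as conjugation inverts the values of `χ`. -/
theorem jacobiSum_mul_star :
    jacobiSum (hF.quarticChar hπ hodd) (hF.quarticChar hπ hodd) *
      star (jacobiSum (hF.quarticChar hπ hodd) (hF.quarticChar hπ hodd)) = π.norm := by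
  apply toComplex_injective
  set χ := (hF.quarticChar hπ hodd).ringHomComp toComplex with hχ
  have h1 : ringChar ℂ ≠ ringChar F := by
    rw [ringChar.eq_zero]
    exact (CharP.ringChar_ne_zero_of_finite F).symm
  have h3 := jacobiSum_mul_jacobiSum_inv h1
    (hF.quarticChar_comp_ne_one hπ hodd toComplex two_ne_zero)
    (hF.quarticChar_comp_ne_one hπ hodd toComplex two_ne_zero)
    (by rw [← sq]; exact hF.quarticChar_comp_sq_ne_one hπ hodd toComplex two_ne_zero)
  have h4 : jacobiSum χ⁻¹ χ⁻¹ = star (jacobiSum χ χ) := by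
    simp only [jacobiSum, star_sum, star_mul', MulChar.star_apply']
  rw [← hχ, h4, hχ, jacobiSum_ringHomComp, hF.card] at h3
  rw [map_mul, toComplex_star]
  refine h3.trans ?_
  rw [natCast_natAbs_norm, map_intCast]

theorem norm_jacobiSum :
    (jacobiSum (hF.quarticChar hπ hodd) (hF.quarticChar hπ hodd)).norm = π.norm := by
  have := hF.jacobiSum_mul_star hπ hodd
  rw [← Zsqrtd.norm_eq_mul_conj] at this
  exact_mod_cast this

theorem isPrimitiveRoot_I : IsPrimitiveRoot I 4 := by
  refine IsPrimitiveRoot.mk_of_lt _ (by norm_num) I_pow_four fun l h0 h4 => ?_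
  interval_cases l <;> decide

theorem even_im_jacobiSum :
    Even (jacobiSum (hF.quarticChar hπ hodd) (hF.quarticChar hπ hodd)).im := by
  obtain ⟨z, -, hz⟩ := exists_jacobiSum_eq_neg_one_add (by norm_num : 2 < 4)
    (hF.quarticChar_pow_four hπ hodd) (hF.quarticChar_pow_four hπ hodd)
    (by rw [hF.card_eq hodd]; simp) isPrimitiveRoot_I
  rw [hz, show (I - 1) ^ 2 = 2 * -I by decide]
  refine ⟨-z.re, ?_⟩
  simp
  ring

/-- Divisibility and equality of norms give `J = uπ` with `u` a unit, and the parity of the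
imaginary parts forces `u = ±1`. The sign is irrelevant, since only `J²` enters `g⁴`. -/
theorem jacobiSum_sq (him : Even π.im) :
    jacobiSum (hF.quarticChar hπ hodd) (hF.quarticChar hπ hodd) ^ 2 = π ^ 2 := by
  have h1 := hF.norm_jacobiSum hπ hodd
  have h2 := hF.even_im_jacobiSum hπ hodd
  obtain ⟨u, hu⟩ := hF.dvd_jacobiSum hπ hodd
  rw [hu] at h1 h2 ⊢
  have hre : Odd π.re := by
    rw [norm_eq_sq_add_sq, Int.odd_add] at hodd
    exact (Int.odd_pow.1 (hodd.2 (him.pow_of_ne_zero two_ne_zero))).resolve_right two_ne_zero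
  have hu1 : u.norm = 1 := by
    rw [Zsqrtd.norm_mul] at h1
    exact mul_left_cancel₀ (by rw [Ne, norm_eq_zero]; exact hπ.ne_zero) (h1.trans (mul_one _).symm)
  have h3 : Even (π.re * u.im) := by
    rw [Zsqrtd.im_mul] at h2
    exact (Int.even_add.1 h2).2 (him.mul_right _)
  have h4 : Even u.im := (Int.even_mul.1 h3).resolve_left (Int.not_even_iff_odd.2 hre)
  rw [norm_eq_sq_add_sq] at hu1
  have h5 : u.im = 0 := by
    obtain ⟨v, hv⟩ := h4
    have hv1 : v < 1 := by nlinarith [sq_nonneg u.re]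
    have hv2 : -1 < v := by nlinarith [sq_nonneg u.re]
    omega
  have h6 : u ^ 2 = 1 := by
    ext
    · simp [sq, h5]
      nlinarith
    · simp [sq, h5]
  rw [mul_pow, h6, mul_one]

end GaussianInt.IsResidueField

/-! ### Frobenius acting on the Gauss sum in characteristic `l`. -/

namespace GaussianInt.IsResidueField

variable {π : GaussianInt} {F : Type} [Field F] [Fintype F] {φ : GaussianInt →+* F}

/-- There is a field of characteristic `l` containing `ℤ[i]/(ρ)`, where `ρ` is a Gaussian prime
above `l`, to which the residue field of `π` has a primitive additive character. -/
theorem exists_primitive_addChar (hF : IsResidueField π F φ) {ρ : GaussianInt} (hρ : Prime ρ)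
    (hρodd : Odd ρ.norm) (l : ℕ) [Fact l.Prime] (hρl : ρ ∣ (l : GaussianInt))
    (hπl : ¬ π ∣ (l : GaussianInt)) :
    ∃ (K : Type) (_ : Field K) (_ : CharP K l) (θ : GaussianInt →+* K) (ψ : AddChar F K),
      ψ.IsPrimitive ∧ (∀ α, θ α = 0 ↔ ρ ∣ α) ∧
      ∀ α, θ α ^ ((ρ.norm.natAbs - 1) / 4) = θ (quarticResidueSymbol α ρ) := by
  obtain ⟨G, _, _, φG, hG⟩ := exists_isResidueField hρ
  have hGl : ringChar G = l := by
    have h1 : (l : G) = 0 := by rw [← map_natCast φG, hG.map_eq_zero_iff]; exact hρl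
    have h2 := (Nat.dvd_prime (Fact.out : l.Prime)).1 (ringChar.dvd h1)
    exact h2.resolve_left (CharP.ringChar_ne_one)
  have hFl : ringChar G ≠ ringChar F := by
    intro h
    apply hπl
    rw [← hF.map_eq_zero_iff, map_natCast, ← hGl, h]
    exact ringChar.Nat.cast_ringChar
  have : CharP G l := hGl ▸ ringChar.charP G
  let ψ := AddChar.FiniteField.primitiveChar F G hFl
  have hinj : Function.Injective (algebraMap G (CyclotomicField ψ.n G)) := RingHom.injective _
  refine ⟨CyclotomicField ψ.n G, inferInstance, charP_of_injective_algebraMap hinj l,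
    (algebraMap G _).comp φG, ψ.char, ψ.prim, fun α => ?_, fun α => ?_⟩
  · rw [RingHom.comp_apply, _root_.map_eq_zero_iff _ hinj, hG.map_eq_zero_iff]
  · rw [RingHom.comp_apply, RingHom.comp_apply, ← map_pow, hG.map_pow_eq_map_symbol hρ hρodd]

variable (hF : IsResidueField π F φ) (hπ : Prime π) (hodd : Odd π.norm)

section

variable {K : Type*} [Field K] (θ : GaussianInt →+* K)

theorem gaussSum_pow_four_eq (h2 : (2 : K) ≠ 0) (him : Even π.im) {ψ : AddChar F K}
    (hψ : ψ.IsPrimitive) :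
    gaussSum ((hF.quarticChar hπ hodd).ringHomComp θ) ψ ^ 4 = θ π ^ 3 * θ (star π) := by
  rw [hF.gaussSum_pow_four hπ hodd θ h2 hψ, ← map_pow, hF.jacobiSum_sq hπ hodd him,
    natCast_natAbs_norm, ← map_intCast θ, Zsqrtd.norm_eq_mul_conj, map_mul, map_pow]
  ring

include hF in
theorem natCast_ne_zero (l : ℕ) (hπl : ¬ π ∣ (l : GaussianInt)) : (l : F) ≠ 0 := by
  rwa [← map_natCast φ, Ne, hF.map_eq_zero_iff]

variable (l : ℕ) [Fact l.Prime] [CharP K l] (hπl : ¬ π ∣ (l : GaussianInt))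

-- Frobenius turns `g(χ,ψ)` into `g(χ^l, ψ^l)`. Here `χ^l = χ`, and the shift of `ψ` by `l` costs a
-- factor `χ(l)`.
include hπl in
theorem gaussSum_pow_char_of_mod_four_eq_one (hl : l % 4 = 1) (ψ : AddChar F K) :
    θ (quarticResidueSymbol l π) * gaussSum ((hF.quarticChar hπ hodd).ringHomComp θ) ψ ^ l =
      gaussSum ((hF.quarticChar hπ hodd).ringHomComp θ) ψ := by
  set χ := (hF.quarticChar hπ hodd).ringHomComp θ with hχ
  have hχ4 : χ ^ 4 = 1 := by
    refine MulChar.ext fun a => ?_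
    rw [MulChar.pow_apply_coe, hχ, MulChar.ringHomComp_apply, ← map_pow,
      quarticChar_apply_pow_four _ _ _ a.ne_zero, MulChar.one_apply_coe, map_one]
  have hχl : χ ^ l = χ := by
    rw [← Nat.div_add_mod l 4, hl, pow_add, pow_mul, hχ4, one_pow, one_mul, pow_one]
  have h1 := gaussSum_mulShift χ ψ (Units.mk0 (l : F) (hF.natCast_ne_zero l hπl))
  rw [gaussSum_frob, hχl, AddChar.pow_mulShift]
  rw [Units.val_mk0] at h1
  rw [← h1]
  congr 1
  rw [hχ, MulChar.ringHomComp_apply, ← map_natCast φ, quarticChar_apply]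

-- Now `χ^l = χ⁻¹`, so `g^(l+1)` is essentially `g(χ) g(χ⁻¹) = χ(-1) Nπ`, up to the factor from
-- shifting `ψ` by `l`.
include hπl in
theorem gaussSum_pow_char_of_mod_four_eq_three (h2 : (2 : K) ≠ 0) (hl : l % 4 = 3)
    {ψ : AddChar F K} (hψ : ψ.IsPrimitive) :
    θ (quarticResidueSymbol l π) ^ 3 *
      gaussSum ((hF.quarticChar hπ hodd).ringHomComp θ) ψ ^ (l + 1) =
      θ (quarticResidueSymbol (-1) π) * (θ π * θ (star π)) := by
  set χ := (hF.quarticChar hπ hodd).ringHomComp θ with hχ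
  have hχ4 : χ ^ 4 = 1 := by
    refine MulChar.ext fun a => ?_
    rw [MulChar.pow_apply_coe, hχ, MulChar.ringHomComp_apply, ← map_pow,
      quarticChar_apply_pow_four _ _ _ a.ne_zero, MulChar.one_apply_coe, map_one]
  have hχ3 : χ ^ 3 = χ⁻¹ := by
    rw [eq_inv_iff_mul_eq_one, ← pow_succ, hχ4]
  have hχl : χ ^ l = χ⁻¹ := by
    rw [← Nat.div_add_mod l 4, hl, pow_add, pow_mul, hχ4, one_pow, one_mul, hχ3]
  have hχφ (α : GaussianInt) : χ (φ α) = θ (quarticResidueSymbol α π) := by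
    rw [hχ, MulChar.ringHomComp_apply, quarticChar_apply]
  have h1 := gaussSum_mulShift χ⁻¹ ψ (Units.mk0 (l : F) (hF.natCast_ne_zero l hπl))
  rw [Units.val_mk0, ← AddChar.pow_mulShift] at h1
  have h3 := gaussSum_mul_gaussSum_eq_card (hF.quarticChar_comp_ne_one hπ hodd θ h2) hψ
  have h4 := mul_gaussSum_inv_eq_gaussSum χ⁻¹ ψ
  have h5 : χ⁻¹ (l : F) = θ (quarticResidueSymbol l π) ^ 3 := by
    rw [← hχ3, MulChar.pow_apply' _ three_ne_zero, ← map_natCast φ, hχφ]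
  have h6 : χ⁻¹ (-1 : F) = θ (quarticResidueSymbol (-1) π) := by
    have h7 : χ (-1) ^ 2 = 1 := by rw [← map_pow, neg_one_sq, map_one]
    rw [← hχ3, MulChar.pow_apply' _ three_ne_zero, pow_succ, h7, one_mul, ← hχφ, map_neg φ,
      map_one φ]
  have hcard : (Fintype.card F : K) = θ π * θ (star π) := by
    rw [hF.card, natCast_natAbs_norm, ← map_intCast θ, Zsqrtd.norm_eq_mul_conj, map_mul]
  rw [← hχ, hcard] at h3
  rw [← h5, ← h6, ← h3, pow_succ, gaussSum_frob, hχl, ← mul_assoc, h1, ← h4]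
  ring

end

end GaussianInt.IsResidueField

/-! ### Reciprocity between a rational prime and a Gaussian prime. -/

namespace GaussianInt

theorem prime_star {π : GaussianInt} (hπ : Prime π) : Prime (star π) :=
  (MulEquiv.prime_iff (starRingAut (R := GaussianInt))).2 (by simpa using hπ)

/-- Frobenius fixes rational integers and sends `i` to `i^l = -i`. -/
theorem map_star_eq_pow_char {K : Type*} [Field K] (l : ℕ) [Fact l.Prime] [CharP K l]
    (hl : l % 4 = 3) (θ : GaussianInt →+* K) (α : GaussianInt) : θ (star α) = θ α ^ l := by
  have h1 (n : ℤ) : (n : K) ^ l = n := by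
    rw [← frobenius_def, map_intCast]
  have h2 : I ^ l = -I := by
    rw [← Nat.div_add_mod l 4, hl, pow_add, pow_mul, I_pow_four, one_pow, one_mul]
    decide
  have h3 : α = α.re + α.im * I := by ext <;> simp
  have h4 : star α = α.re + α.im * -I := by ext <;> simp
  rw [h4, ← h2]
  conv_rhs => rw [h3]
  simp only [map_add, map_mul, map_intCast, map_pow]
  rw [add_pow_char, mul_pow, h1, h1]

theorem not_dvd_of_prime_dvd_natCast {π : GaussianInt} {l : ℕ}
    (hlπ : ¬ π ∣ (l : GaussianInt)) {ρ : GaussianInt} (hρ : Prime ρ) (hρl : ρ ∣ (l : GaussianInt))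
    (hπ : Prime π) : ¬ ρ ∣ π := by
  intro h
  exact hlπ (((hρ.associated_of_dvd hπ h).dvd_iff_dvd_left).1 hρl)

theorem symbol_natCast_of_mod_four_eq_three {π : GaussianInt} (hπ : Prime π) (hodd : Odd π.norm)
    (him : Even π.im) (l : ℕ) [Fact l.Prime] (hl : l % 4 = 3) (hπl : ¬ π ∣ (l : GaussianInt)) :
    quarticResidueSymbol π l = quarticResidueSymbol (-l) π := by
  have hρ : Prime (l : GaussianInt) := prime_of_nat_prime_of_mod_four_eq_three l hl
  have hnorm : (l : GaussianInt).norm = l * l := Zsqrtd.norm_natCast l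
  have hρodd : Odd (l : GaussianInt).norm := by
    rw [hnorm, Int.odd_mul, Int.odd_coe_nat, Nat.odd_iff]
    omega
  have hlπ : ¬ (l : GaussianInt) ∣ π := not_dvd_of_prime_dvd_natCast hπl hρ dvd_rfl hπ
  obtain ⟨F, _, _, φ, hF⟩ := exists_isResidueField hπ
  obtain ⟨K, _, _, θ, ψ, hψ, hker, hpow⟩ := hF.exists_primitive_addChar hρ hρodd l dvd_rfl hπl
  have h2 : (2 : K) ≠ 0 := by
    have : ((2 : ℕ) : K) ≠ 0 := by
      rw [Ne, CharP.cast_eq_zero_iff K l, Nat.prime_dvd_prime_iff_eq Fact.out Nat.prime_two]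
      omega
    exact_mod_cast this
  have hP : θ π ≠ 0 := by rwa [Ne, hker]
  have h3 := hF.gaussSum_pow_char_of_mod_four_eq_three hπ hodd θ l hπl h2 hl hψ
  have h4 := hF.gaussSum_pow_four_eq hπ hodd θ h2 him hψ
  have h5 := map_star_eq_pow_char l hl θ π
  obtain ⟨m, hm⟩ : ∃ m, l = 4 * m + 3 := ⟨l / 4, by omega⟩
  have hn : ((l : GaussianInt).norm.natAbs - 1) / 4 = (4 * m + 2) * (m + 1) := by
    have : (l : GaussianInt).norm.natAbs = 4 * ((4 * m + 2) * (m + 1)) + 1 := by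
      rw [hnorm, Int.natAbs_mul, Int.natAbs_natCast, hm]
      ring
    omega
  have h6 := hpow π
  rw [hn] at h6
  rw [show l + 1 = 4 * (m + 1) by omega, pow_mul, h4, h5] at h3
  -- The exponent splits as `(l+3)(m+1) = (l²-1)/4 + (l+1)`; the first part produces `(π/l)₄` and
  -- the second cancels against `π π̄ = π^(l+1)`.
  have h7 : (θ π ^ 3 * θ π ^ l) ^ (m + 1) =
      θ π ^ ((4 * m + 2) * (m + 1)) * (θ π * θ π ^ l) := by
    rw [hm]; ring
  rw [h7, h6, ← mul_assoc, mul_left_inj' (mul_ne_zero hP (pow_ne_zero _ hP)), ← map_pow, ← map_mul,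
    ← sub_eq_zero, ← map_sub, hker] at h3
  have hs := quarticResidueSymbol_pow_four hρ hρodd hlπ
  have ht := quarticResidueSymbol_pow_four hπ hodd hπl
  have hu := quarticResidueSymbol_pow_four hπ hodd (α := -1)
    (by rw [dvd_neg]; exact hπ.not_dvd_one)
  have h8 := eq_of_dvd_sub_of_pow_four hρ hρodd
    (by rw [mul_pow, ← pow_mul, mul_comm 3, pow_mul, ht, hs, one_pow, one_mul]) hu h3
  rw [neg_eq_neg_one_mul (l : GaussianInt), quarticResidueSymbol_mul hπ hodd, ← h8]
  linear_combination (-quarticResidueSymbol π l) * ht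

theorem symbol_natCast_of_mod_four_eq_one {π : GaussianInt} (hπ : Prime π) (hodd : Odd π.norm)
    (him : Even π.im) (l : ℕ) [Fact l.Prime] (hl : l % 4 = 1) (hπl : ¬ π ∣ (l : GaussianInt))
    {ρ : GaussianInt} (hρ : Prime ρ) (hnorm : ρ.norm = l) :
    quarticResidueSymbol π ρ * quarticResidueSymbol π (star ρ) = quarticResidueSymbol l π := by
  have hρodd : Odd ρ.norm := by
    rw [hnorm, Int.odd_coe_nat, Nat.odd_iff]
    omega
  have hlρ : (l : GaussianInt) = ρ * star ρ := by
    rw [← Zsqrtd.norm_eq_mul_conj, hnorm, Int.cast_natCast]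
  have hρl : ρ ∣ (l : GaussianInt) := Dvd.intro _ hlρ.symm
  have hρl' : star ρ ∣ (l : GaussianInt) := Dvd.intro_left _ hlρ.symm
  obtain ⟨F, _, _, φ, hF⟩ := exists_isResidueField hπ
  obtain ⟨K, _, _, θ, ψ, hψ, hker, hpow⟩ := hF.exists_primitive_addChar hρ hρodd l hρl hπl
  have h2 : (2 : K) ≠ 0 := by
    have : ((2 : ℕ) : K) ≠ 0 := by
      rw [Ne, CharP.cast_eq_zero_iff K l, Nat.prime_dvd_prime_iff_eq Fact.out Nat.prime_two]
      omega
    exact_mod_cast this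
  have hπρ : ¬ ρ ∣ π := not_dvd_of_prime_dvd_natCast hπl hρ hρl hπ
  have hπρ' : ¬ star ρ ∣ π := not_dvd_of_prime_dvd_natCast hπl (prime_star hρ) hρl' hπ
  have hπρ'' : ¬ ρ ∣ star π := by
    intro h
    have := map_dvd (starRingEnd GaussianInt) h
    rw [starRingEnd_apply, starRingEnd_apply, star_star] at this
    exact hπρ' this
  have h3 := hF.gaussSum_pow_char_of_mod_four_eq_one hπ hodd θ l hπl hl ψ
  have h4 := hF.gaussSum_pow_four_eq hπ hodd θ h2 him hψ
  have hg : gaussSum ((hF.quarticChar hπ hodd).ringHomComp θ) ψ ≠ 0 := by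
    intro h0
    rw [h0, zero_pow four_ne_zero, eq_comm, mul_eq_zero, pow_eq_zero_iff three_ne_zero, hker, hker]
      at h4
    exact h4.elim hπρ hπρ''
  obtain ⟨m, hm⟩ : ∃ m, l = 4 * m + 1 := ⟨l / 4, by omega⟩
  have hn : (ρ.norm.natAbs - 1) / 4 = m := by
    rw [hnorm, Int.natAbs_natCast]
    omega
  rw [hn] at hpow
  rw [hm, pow_succ, pow_mul, h4, ← hm, ← mul_assoc] at h3
  have h5 := mul_right_cancel₀ hg (h3.trans (one_mul _).symm)
  -- The resulting relation is `(l/π)₄ (π/ρ)₄³ (π̄/ρ)₄ = 1`. Conjugation then gives `(π̄/ρ)₄ =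
  -- (π/ρ̄)₄³`.
  rw [mul_pow, ← pow_mul, mul_comm 3, pow_mul, hpow, hpow, ← map_pow, ← map_mul, ← map_mul,
    ← map_one θ, ← sub_eq_zero, ← map_sub, hker] at h5
  have hs := quarticResidueSymbol_pow_four hρ hρodd hπρ
  have ht := quarticResidueSymbol_pow_four (prime_star hρ) (by rwa [Zsqrtd.norm_conj]) hπρ'
  have hs' := quarticResidueSymbol_pow_four hρ hρodd hπρ''
  have hu := quarticResidueSymbol_pow_four hπ hodd hπl
  have h6 := eq_of_dvd_sub_of_pow_four hρ hρodd
    (by simp only [mul_pow, ← pow_mul, hu, hs']; rw [mul_comm 3, pow_mul, hs]; simp)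
    (one_pow 4) h5
  have h7 := quarticResidueSymbol_star (prime_star hρ) (by rwa [Zsqrtd.norm_conj]) π
  rw [star_star, star_eq_cube_of_pow_four ht] at h7
  rw [h7] at h6
  set s := quarticResidueSymbol π ρ
  set t := quarticResidueSymbol π (star ρ)
  set u := quarticResidueSymbol (l : GaussianInt) π
  linear_combination (-(s * t)) * h6 + u * t ^ 4 * hs + u * ht

/-! ### Induction along prime factors, and primality from the norm. -/

theorem odd_norm_induction {P : GaussianInt → Prop} (unit : ∀ u, IsUnit u → P u)
    (prime_mul : ∀ π β, Prime π → Odd π.norm → Odd β.norm → P β → P (π * β)) {β : GaussianInt}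
    (hβ : Odd β.norm) : P β := by
  induction β using UniqueFactorizationMonoid.induction_on_prime with
  | h₁ => simp at hβ
  | h₂ u hu => exact unit u hu
  | h₃ a p ha hp ih =>
    have h := hβ
    rw [Zsqrtd.norm_mul, Int.odd_mul] at h
    exact prime_mul p a hp h.1 h.2 (ih h.2)

theorem prime_of_prime_norm {π : GaussianInt} {p : ℕ} (hp : p.Prime) (h : π.norm = p) :
    Prime π := by
  refine Irreducible.prime ⟨fun hu => ?_, fun x y hxy => ?_⟩
  · have := Zsqrtd.norm_eq_one_iff.2 hu
    rw [h, Int.natAbs_natCast] at this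
    exact hp.one_lt.ne' this
  · rw [hxy, Zsqrtd.norm_mul] at h
    have h2 : x.norm.natAbs * y.norm.natAbs = p := by
      rw [← Int.natAbs_mul, h, Int.natAbs_natCast]
    rw [← Zsqrtd.norm_eq_one_iff, ← Zsqrtd.norm_eq_one_iff]
    exact (((Nat.irreducible_iff_nat_prime p).2 hp).isUnit_or_isUnit h2.symm).imp
      Nat.isUnit_iff.1 Nat.isUnit_iff.1

theorem not_dvd_of_isCoprime {π α : GaussianInt} (hπ : Prime π) (h : IsCoprime α π) : ¬ π ∣ α :=
  fun h' => hπ.not_isUnit (h.isUnit_of_dvd' h' dvd_rfl)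

theorem odd_norm_intCast {n : ℤ} (hn : Odd n) : Odd (n : GaussianInt).norm := by
  rw [Zsqrtd.norm_intCast]
  exact hn.mul hn

theorem odd_re_of_even_im {α : GaussianInt} (h : Odd α.norm) (him : Even α.im) : Odd α.re := by
  rw [norm_eq_sq_add_sq, Int.odd_add] at h
  exact (Int.odd_pow.1 (h.2 (him.pow_of_ne_zero two_ne_zero))).resolve_right two_ne_zero

end GaussianInt

/-! ### The quartic Jacobi symbol. -/

theorem quarticJacobiSymbol_isUnit {u : GaussianInt} (hu : IsUnit u) (α : GaussianInt) :
    quarticJacobiSymbol α u = 1 := by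
  have : UniqueFactorizationMonoid.factors u = 0 := by
    refine Multiset.eq_zero_of_forall_notMem fun p hp => ?_
    exact (UniqueFactorizationMonoid.prime_of_factor p hp).not_isUnit
      (isUnit_of_dvd_unit (UniqueFactorizationMonoid.dvd_of_mem_factors hp) hu)
  rw [quarticJacobiSymbol, this, Multiset.map_zero, Multiset.prod_zero]

theorem quarticJacobiSymbol_prime {π : GaussianInt} (hπ : Prime π) (α : GaussianInt) :
    quarticJacobiSymbol α π = quarticResidueSymbol α π := by
  obtain ⟨b, hb, h⟩ := UniqueFactorizationMonoid.factors_eq_singleton_of_irreducible hπ.irreducible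
  rw [quarticJacobiSymbol, h, Multiset.map_singleton, Multiset.prod_singleton,
    quarticResidueSymbol_associated hb]

theorem quarticJacobiSymbol_mul_right (α : GaussianInt) {β γ : GaussianInt} (hβ : β ≠ 0)
    (hγ : γ ≠ 0) :
    quarticJacobiSymbol α (β * γ) = quarticJacobiSymbol α β * quarticJacobiSymbol α γ := by
  have h := UniqueFactorizationMonoid.factors_mul hβ hγ
  simp only [quarticJacobiSymbol]
  rw [← Multiset.prod_add, ← Multiset.map_add]
  congr 1
  rw [← Multiset.rel_eq, Multiset.rel_map]
  exact h.mono fun a _ b _ hab => quarticResidueSymbol_associated hab α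

theorem quarticJacobiSymbol_associated {β γ : GaussianInt} (h : Associated β γ)
    (α : GaussianInt) : quarticJacobiSymbol α β = quarticJacobiSymbol α γ := by
  obtain ⟨u, rfl⟩ := h
  by_cases hβ : β = 0
  · rw [hβ, zero_mul]
  · rw [quarticJacobiSymbol_mul_right α hβ u.ne_zero, quarticJacobiSymbol_isUnit u.isUnit, mul_one]

theorem quarticJacobiSymbol_prime_mul {π β : GaussianInt} (hπ : Prime π) (hβ : Odd β.norm)
    (α : GaussianInt) : quarticJacobiSymbol α (π * β) =
      quarticResidueSymbol α π * quarticJacobiSymbol α β := by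
  rw [quarticJacobiSymbol_mul_right α hπ.ne_zero (ne_zero_of_norm_odd hβ),
    quarticJacobiSymbol_prime hπ]

theorem quarticJacobiSymbol_mul {β : GaussianInt} (hβ : Odd β.norm) (α γ : GaussianInt) :
    quarticJacobiSymbol (α * γ) β = quarticJacobiSymbol α β * quarticJacobiSymbol γ β := by
  refine odd_norm_induction (P := fun β => quarticJacobiSymbol (α * γ) β =
    quarticJacobiSymbol α β * quarticJacobiSymbol γ β) (fun u hu => ?_)
    (fun π β hπ hodd hβ ih => ?_) hβ
  · simp only [quarticJacobiSymbol_isUnit hu, mul_one]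
  · simp only [quarticJacobiSymbol_prime_mul hπ hβ, quarticResidueSymbol_mul hπ hodd, ih]
    ring

theorem quarticJacobiSymbol_congr {β : GaussianInt} (hβ : Odd β.norm) {α γ : GaussianInt}
    (h : β ∣ α - γ) : quarticJacobiSymbol α β = quarticJacobiSymbol γ β := by
  refine odd_norm_induction (P := fun β => β ∣ α - γ → quarticJacobiSymbol α β =
    quarticJacobiSymbol γ β) (fun u hu _ => ?_) (fun π β hπ hodd hβ ih h => ?_) hβ h
  · simp only [quarticJacobiSymbol_isUnit hu]
  · rw [quarticJacobiSymbol_prime_mul hπ hβ, quarticJacobiSymbol_prime_mul hπ hβ,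
      quarticResidueSymbol_congr hπ hodd (dvd_of_mul_right_dvd h), ih (dvd_of_mul_left_dvd h)]

theorem quarticJacobiSymbol_pow_four {β : GaussianInt} (hβ : Odd β.norm) {α : GaussianInt}
    (h : IsCoprime α β) : quarticJacobiSymbol α β ^ 4 = 1 := by
  refine odd_norm_induction (P := fun β => IsCoprime α β → quarticJacobiSymbol α β ^ 4 = 1)
    (fun u hu _ => ?_) (fun π β hπ hodd hβ ih h => ?_) hβ h
  · rw [quarticJacobiSymbol_isUnit hu, one_pow]
  · rw [quarticJacobiSymbol_prime_mul hπ hβ, mul_pow, ih h.of_mul_right_right, mul_one]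
    exact quarticResidueSymbol_pow_four hπ hodd (not_dvd_of_isCoprime hπ h.of_mul_right_left)

theorem quarticJacobiSymbol_one {β : GaussianInt} (hβ : Odd β.norm) :
    quarticJacobiSymbol 1 β = 1 := by
  refine odd_norm_induction (P := fun β => quarticJacobiSymbol 1 β = 1)
    (fun u hu => quarticJacobiSymbol_isUnit hu 1) (fun π β hπ hodd hβ ih => ?_) hβ
  rw [quarticJacobiSymbol_prime_mul hπ hβ, ih, mul_one]
  exact quarticResidueSymbol_eq_of_dvd hπ hodd (one_pow 4) (by simp)

theorem quarticJacobiSymbol_pow {β : GaussianInt} (hβ : Odd β.norm) (α : GaussianInt) (n : ℕ) :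
    quarticJacobiSymbol (α ^ n) β = quarticJacobiSymbol α β ^ n := by
  induction n with
  | zero => rw [pow_zero, pow_zero, quarticJacobiSymbol_one hβ]
  | succ n ih => rw [pow_succ, pow_succ, quarticJacobiSymbol_mul hβ, ih]

/-- For norms `4a+1` and `4b+1` the product is `4(4ab+a+b)+1`, so the exponent is additive modulo 4.
-/
theorem quarticJacobiSymbol_I {β : GaussianInt} (hβ : Odd β.norm) :
    quarticJacobiSymbol I β = I ^ ((β.norm.natAbs - 1) / 4) := by
  refine odd_norm_induction (P := fun β => quarticJacobiSymbol I β = I ^ ((β.norm.natAbs - 1) / 4))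
    (fun u hu => ?_) (fun π β hπ hodd hβ ih => ?_) hβ
  · rw [quarticJacobiSymbol_isUnit hu, Zsqrtd.norm_eq_one_iff.2 hu]
    simp
  · have h1 := natAbs_norm_eq_four_mul hodd
    have h2 := natAbs_norm_eq_four_mul hβ
    rw [quarticJacobiSymbol_prime_mul hπ hβ, ih, quarticResidueSymbol_eq_of_dvd hπ hodd
      (s := I ^ ((π.norm.natAbs - 1) / 4)) (by rw [← pow_mul, mul_comm, pow_mul, I_pow_four, one_pow])
      (by simp), ← pow_add]
    set a := (π.norm.natAbs - 1) / 4
    set b := (β.norm.natAbs - 1) / 4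
    have h3 : ((π * β).norm.natAbs - 1) / 4 = 4 * (a * b) + (a + b) := by
      have : (π * β).norm.natAbs = 4 * (4 * (a * b) + (a + b)) + 1 := by
        rw [Zsqrtd.norm_mul, Int.natAbs_mul, h1, h2]
        ring
      omega
    rw [h3, pow_add I (4 * (a * b)), pow_mul, I_pow_four, one_pow, one_mul]

theorem quarticJacobiSymbol_natCast_right (l : ℕ) [Fact l.Prime] (hl : Odd l) :
    (l % 4 = 3 ∧ Prime (l : GaussianInt)) ∨
    (l % 4 = 1 ∧ ∃ ρ : GaussianInt, Prime ρ ∧ ρ.norm = l ∧ ∀ α, quarticJacobiSymbol α l =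
      quarticResidueSymbol α ρ * quarticResidueSymbol α (star ρ)) := by
  have h4 : l % 4 = 3 ∨ l % 4 = 1 := by
    rw [Nat.odd_iff] at hl
    omega
  refine h4.imp (fun h => ⟨h, prime_of_nat_prime_of_mod_four_eq_three l h⟩) fun h => ⟨h, ?_⟩
  have h1 : ¬ Irreducible (l : GaussianInt) := by
    rw [irreducible_iff_prime, prime_iff_mod_four_eq_three_of_nat_prime]
    omega
  obtain ⟨a, b, hab⟩ := sq_add_sq_of_nat_prime_of_not_irreducible l h1
  have hnorm : (⟨a, b⟩ : GaussianInt).norm = l := by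
    rw [norm_eq_sq_add_sq, ← hab]
    push_cast
    ring
  have hρ := prime_of_prime_norm (Fact.out : l.Prime) hnorm
  refine ⟨⟨a, b⟩, hρ, hnorm, fun α => ?_⟩
  have h3 : (l : GaussianInt) = ⟨a, b⟩ * star ⟨a, b⟩ := by
    rw [← Zsqrtd.norm_eq_mul_conj, hnorm, Int.cast_natCast]
  rw [h3, quarticJacobiSymbol_mul_right α hρ.ne_zero (prime_star hρ).ne_zero,
    quarticJacobiSymbol_prime hρ, quarticJacobiSymbol_prime (prime_star hρ)]

theorem associated_intCast_natAbs (n : ℤ) : Associated (n : GaussianInt) (n.natAbs : GaussianInt) := by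
  have := (Int.associated_natAbs n).map (Int.castRingHom GaussianInt)
  simpa using this

/-- If `l ≡ 3 (mod 4)`, the exponent `(l²-1)/4` is a multiple of `l-1` and Fermat's theorem applies.
If `l = ρρ̄`, the symbols of `m` modulo `ρ` and `ρ̄` are conjugate, with product 1. -/
theorem quarticJacobiSymbol_intCast_natCast (l : ℕ) [Fact l.Prime] (hl : Odd l) {m : ℤ}
    (h : IsCoprime (m : GaussianInt) l) : quarticJacobiSymbol m l = 1 := by
  have hFermat : (l : ℤ) ∣ m ^ (l - 1) - 1 := by
    have hlm : ¬ (l : ℤ) ∣ m := by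
      intro hlm
      have h1 : (l : GaussianInt) ∣ m := by exact_mod_cast (Zsqrtd.intCast_dvd_intCast (d := -1) l m).2 hlm
      have h2 := Zsqrtd.norm_eq_one_iff.2 (h.isUnit_of_dvd' h1 dvd_rfl)
      rw [Zsqrtd.norm_natCast, Int.natAbs_mul, Int.natAbs_natCast] at h2
      have := (Fact.out : l.Prime).one_lt
      nlinarith
    rw [← ZMod.intCast_zmod_eq_zero_iff_dvd, Int.cast_sub, Int.cast_pow, Int.cast_one,
      ZMod.pow_card_sub_one_eq_one, sub_self]
    rwa [Ne, ZMod.intCast_zmod_eq_zero_iff_dvd]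
  rcases quarticJacobiSymbol_natCast_right l hl with ⟨h4, hp⟩ | ⟨h4, ρ, hρ, hnorm, h1⟩
  · have hnorm : (l : GaussianInt).norm = l * l := Zsqrtd.norm_natCast l
    have hodd : Odd (l : GaussianInt).norm := by
      rw [hnorm]
      exact_mod_cast hl.mul hl
    rw [quarticJacobiSymbol_prime hp]
    refine quarticResidueSymbol_eq_of_dvd hp hodd (one_pow 4) ?_
    obtain ⟨k, hk⟩ : ∃ k, l = 4 * k + 3 := ⟨l / 4, by omega⟩
    have hn : ((l : GaussianInt).norm.natAbs - 1) / 4 = (l - 1) * (k + 1) := by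
      have : (l : GaussianInt).norm.natAbs = 4 * ((l - 1) * (k + 1)) + 1 := by
        rw [hnorm, Int.natAbs_mul, Int.natAbs_natCast, hk]
        simp only [show 4 * k + 3 - 1 = 4 * k + 2 by omega]
        ring
      omega
    rw [hn, pow_mul]
    have h2 : (l : GaussianInt) ∣ (m : GaussianInt) ^ (l - 1) - 1 := by
      have := (Zsqrtd.intCast_dvd_intCast (d := -1) _ _).2 hFermat
      push_cast at this
      exact this
    exact h2.trans (sub_one_dvd_pow_sub_one _ _)
  · have hodd : Odd ρ.norm := by rw [hnorm]; exact_mod_cast hl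
    have hρl : ρ ∣ (l : GaussianInt) := by
      rw [← Int.cast_natCast, ← hnorm, Zsqrtd.norm_eq_mul_conj]
      exact dvd_mul_right _ _
    have h2 := quarticResidueSymbol_star hρ hodd (m : GaussianInt)
    rw [star_intCast] at h2
    rw [h1, h2, mul_comm]
    exact star_mul_self_of_pow_four (quarticResidueSymbol_pow_four hρ hodd
      (fun h3 => hρ.not_isUnit (h.isUnit_of_dvd' h3 hρl)))

/-- Induction over the odd integers along their prime factors. -/
theorem Int.odd_induction {P : ℤ → Prop} (unit : ∀ u, IsUnit u → P u)
    (prime_mul : ∀ (p n : ℤ), Nat.Prime p.natAbs → Odd p → Odd n → P n → P (p * n)) {n : ℤ}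
    (hn : Odd n) : P n := by
  induction n using UniqueFactorizationMonoid.induction_on_prime with
  | h₁ => simp at hn
  | h₂ u hu => exact unit u hu
  | h₃ a p ha hp ih =>
    have h := Int.odd_mul.1 hn
    exact prime_mul p a (Int.prime_iff_natAbs_prime.1 hp) h.1 h.2 (ih h.2)

theorem quarticJacobiSymbol_int_mul_right (α : GaussianInt) {p n : ℤ} (hp : Odd p) (hn : Odd n) :
    quarticJacobiSymbol α ((p * n : ℤ) : GaussianInt) =
      quarticJacobiSymbol α (p.natAbs : GaussianInt) * quarticJacobiSymbol α n := by
  rw [Int.cast_mul, quarticJacobiSymbol_mul_right α (ne_zero_of_norm_odd (odd_norm_intCast hp))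
    (ne_zero_of_norm_odd (odd_norm_intCast hn)),
    quarticJacobiSymbol_associated (associated_intCast_natAbs p)]

theorem isCoprime_natAbs_right {α : GaussianInt} {n : ℤ} :
    IsCoprime α (n.natAbs : GaussianInt) ↔ IsCoprime α n :=
  ⟨fun h => h.of_isCoprime_of_dvd_right (associated_intCast_natAbs n).dvd,
    fun h => h.of_isCoprime_of_dvd_right (associated_intCast_natAbs n).symm.dvd⟩

/-- The quartic symbol of coprime rational integers is trivial. -/
theorem quarticJacobiSymbol_intCast_intCast {m n : ℤ} (hn : Odd n)
    (h : IsCoprime (m : GaussianInt) n) : quarticJacobiSymbol m n = 1 := by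
  refine Int.odd_induction (P := fun n => IsCoprime (m : GaussianInt) n →
    quarticJacobiSymbol m n = 1) (fun u hu _ => ?_) (fun p n hp hpodd hn ih h => ?_) hn h
  · exact quarticJacobiSymbol_isUnit (hu.map (Int.castRingHom GaussianInt)) _
  · have : Fact p.natAbs.Prime := ⟨hp⟩
    rw [Int.cast_mul] at h
    rw [quarticJacobiSymbol_int_mul_right _ hpodd hn, ih h.of_mul_right_right, mul_one]
    exact quarticJacobiSymbol_intCast_natCast _ (Int.natAbs_odd.2 hpodd)
      (isCoprime_natAbs_right.2 h.of_mul_right_left)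

/-! ### Reciprocity for composite arguments. -/

namespace GaussianInt

/-- The integer `±n` that is congruent to `1` modulo `4`, for odd `n`. -/
def primary (n : ℤ) : ℤ := ZMod.χ₄ n * n

theorem primary_mul (m n : ℤ) : primary (m * n) = primary m * primary n := by
  rw [primary, primary, primary, Int.cast_mul, map_mul]
  ring

theorem primary_of_mod_four_eq_one {n : ℤ} (h : n % 4 = 1) : primary n = n := by
  rw [primary, ZMod.χ₄_int_one_mod_four h, one_mul]

theorem primary_of_mod_four_eq_three {n : ℤ} (h : n % 4 = 3) : primary n = -n := by
  rw [primary, ZMod.χ₄_int_three_mod_four h, neg_one_mul]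

theorem primary_neg {n : ℤ} (hn : Odd n) : primary (-n) = primary n := by
  have : n % 4 = 1 ∨ n % 4 = 3 := by
    rw [Int.odd_iff] at hn
    omega
  rcases this with h | h
  · rw [primary_of_mod_four_eq_one h, primary_of_mod_four_eq_three (by omega), neg_neg]
  · rw [primary_of_mod_four_eq_three h, primary_of_mod_four_eq_one (by omega)]

theorem primary_natAbs {n : ℤ} (hn : Odd n) : primary n.natAbs = primary n := by
  rcases Int.natAbs_eq n with h | h
  · rw [← h]
  · conv_rhs => rw [h, primary_neg (by exact_mod_cast Int.natAbs_odd.2 hn)]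

theorem exists_unit_mul_even_im {α : GaussianInt} (h : Odd α.norm) :
    ∃ u : GaussianIntˣ, Even (u * α).im := by
  rcases Int.even_or_odd α.im with him | him
  · exact ⟨1, by simpa using him⟩
  · refine ⟨⟨I, -I, by decide, by decide⟩, ?_⟩
    rw [norm_eq_sq_add_sq, Int.odd_add] at h
    have : Even α.re := by
      rw [← Int.not_odd_iff_even]
      intro h1
      exact Int.not_even_iff_odd.2 (him.pow (n := 2)) (h.1 h1.pow)
    simpa using this

end GaussianInt

theorem quarticJacobiSymbol_reciprocity_of_prime {π : GaussianInt} (hπ : Prime π)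
    (hodd : Odd π.norm) (him : Even π.im) (l : ℕ) [Fact l.Prime] (hl : Odd l)
    (h : IsCoprime (l : GaussianInt) π) :
    quarticResidueSymbol (primary l : GaussianInt) π = quarticJacobiSymbol π l := by
  have hπl := not_dvd_of_isCoprime hπ h
  rcases quarticJacobiSymbol_natCast_right l hl with ⟨h4, hp⟩ | ⟨h4, ρ, hρ, hnorm, h1⟩
  · rw [quarticJacobiSymbol_prime hp, primary_of_mod_four_eq_three (by exact_mod_cast h4),
      symbol_natCast_of_mod_four_eq_three hπ hodd him l h4 hπl, Int.cast_neg, Int.cast_natCast]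
  · rw [h1, symbol_natCast_of_mod_four_eq_one hπ hodd him l h4 hπl hρ hnorm,
      primary_of_mod_four_eq_one (by exact_mod_cast h4), Int.cast_natCast]

theorem quarticJacobiSymbol_reciprocity_natCast (l : ℕ) [Fact l.Prime] (hl : Odd l)
    {β : GaussianInt} (hβ : Odd β.norm) (him : Even β.im) (h : IsCoprime (l : GaussianInt) β) :
    quarticJacobiSymbol (primary l : GaussianInt) β = quarticJacobiSymbol β l := by
  have hlodd : Odd (l : GaussianInt).norm := by
    have := odd_norm_intCast (n := l) (by exact_mod_cast hl)
    rwa [Int.cast_natCast] at this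
  rw [← one_mul β]
  -- Prime factors of `β` need not have even imaginary part. The claim is therefore carried for all
  -- unit multiples, and each prime is first multiplied by a unit `v` that makes its imaginary part
  -- even.
  refine odd_norm_induction (P := fun β => ∀ u : GaussianIntˣ, Even (u * β).im →
    IsCoprime (l : GaussianInt) β → quarticJacobiSymbol (primary l : GaussianInt) (u * β) =
      quarticJacobiSymbol (u * β) l) (fun v hv u him _ => ?_)
      (fun π β hπ hodd hβ ih u him h => ?_) hβ 1 (by simpa using him) h
  · have hunit : IsUnit (u * v) := u.isUnit.mul hv
    rw [quarticJacobiSymbol_isUnit hunit]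
    have h1 := (Zsqrtd.norm_eq_one_iff' (by norm_num) _).2 hunit
    have h2 := odd_re_of_even_im (by rw [h1]; exact odd_one) him
    rw [norm_eq_sq_add_sq] at h1
    have h3 : (u * v).im = 0 := by
      have : (u * v).re ≠ 0 := by
        intro h0
        rw [h0] at h2
        simp at h2
      have : 0 < (u * v).re ^ 2 := by positivity
      nlinarith [sq_nonneg (u * v).im]
    have h4 : (u * v : GaussianInt) = ((u * v : GaussianInt).re : ℤ) := by
      ext <;> simp [h3]
    rw [h4]
    refine (quarticJacobiSymbol_intCast_natCast l hl ?_).symm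
    rw [← h4]
    exact isCoprime_one_left.of_isCoprime_of_dvd_left hunit.dvd
  · obtain ⟨v, hv⟩ := exists_unit_mul_even_im hodd
    have e : (u * (π * β) : GaussianInt) = (v * π) * ((v⁻¹ * u : GaussianIntˣ) * β) := by
      rw [Units.val_mul]
      linear_combination (-(u * π * β : GaussianInt)) * v.mul_inv
    have hassoc : Associated π (v * π) := ⟨v, mul_comm _ _⟩
    have hassoc' : Associated β ((v⁻¹ * u : GaussianIntˣ) * β) := ⟨v⁻¹ * u, mul_comm _ _⟩
    have hvπ : Prime (v * π) := hassoc.prime hπ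
    have hvodd : Odd (v * π : GaussianInt).norm := by
      rwa [← Zsqrtd.norm_eq_of_associated (by norm_num) hassoc]
    have hβ' : Odd ((v⁻¹ * u : GaussianIntˣ) * β : GaussianInt).norm := by
      rwa [← Zsqrtd.norm_eq_of_associated (by norm_num) hassoc']
    have him' : Even ((v⁻¹ * u : GaussianIntˣ) * β : GaussianInt).im := by
      rw [e, Zsqrtd.im_mul, Int.even_add] at him
      exact (Int.even_mul.1 (him.2 (hv.mul_right _))).resolve_left
        (Int.not_even_iff_odd.2 (odd_re_of_even_im hvodd hv))
    rw [e, quarticJacobiSymbol_prime_mul hvπ hβ', quarticJacobiSymbol_mul hlodd,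
      ih _ him' h.of_mul_right_right, quarticJacobiSymbol_reciprocity_of_prime hvπ hvodd hv l hl
        (h.of_mul_right_left.of_isCoprime_of_dvd_right hassoc.symm.dvd)]

/-- Quartic reciprocity between a rational integer and a Gaussian integer. -/
theorem quarticJacobiSymbol_reciprocity {n : ℤ} (hn : Odd n) {β : GaussianInt} (hβ : Odd β.norm)
    (him : Even β.im) (h : IsCoprime (n : GaussianInt) β) :
    quarticJacobiSymbol (primary n : GaussianInt) β = quarticJacobiSymbol β n := by
  refine Int.odd_induction (P := fun n => IsCoprime (n : GaussianInt) β →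
    quarticJacobiSymbol (primary n : GaussianInt) β = quarticJacobiSymbol β n) (fun u hu _ => ?_)
    (fun p n hp hpodd hn ih h => ?_) hn h
  · have hu' : IsUnit (u : GaussianInt) := hu.map (Int.castRingHom GaussianInt)
    rw [quarticJacobiSymbol_isUnit hu']
    have : primary u = 1 := by
      rcases Int.isUnit_iff.1 hu with rfl | rfl <;> decide
    rw [this, Int.cast_one, quarticJacobiSymbol_one hβ]
  · have : Fact p.natAbs.Prime := ⟨hp⟩
    rw [Int.cast_mul] at h
    rw [quarticJacobiSymbol_int_mul_right _ hpodd hn, primary_mul, Int.cast_mul,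
      quarticJacobiSymbol_mul hβ, ih h.of_mul_left_right, ← primary_natAbs hpodd,
      quarticJacobiSymbol_reciprocity_natCast _ (Int.natAbs_odd.2 hpodd) hβ him
        ((isCoprime_natAbs_right.2 h.of_mul_left_left.symm).symm)]

/-! ### Coprimality by norms, the symbol of `i`, and rational arguments. -/

theorem IsCoprime.gaussianInt_of_norm {n : ℤ} {β : GaussianInt} (h : IsCoprime n β.norm) :
    IsCoprime (n : GaussianInt) β := by
  have h1 := h.map (Int.castRingHom GaussianInt)
  rw [eq_intCast, eq_intCast, Zsqrtd.norm_eq_mul_conj] at h1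
  exact h1.of_mul_right_left

theorem IsCoprime.gaussianInt_intCast {m n : ℤ} (h : IsCoprime m n) :
    IsCoprime (m : GaussianInt) (n : GaussianInt) := by
  simpa using h.map (Int.castRingHom GaussianInt)

theorem quarticJacobiSymbol_I_of_norm {β : GaussianInt} {m : ℤ} (h : β.norm = 4 * m + 1) :
    quarticJacobiSymbol I β = I ^ (m % 4).toNat := by
  have hodd : Odd β.norm := ⟨2 * m, by rw [h]; ring⟩
  have h0 := GaussianInt.norm_nonneg β
  rw [quarticJacobiSymbol_I hodd]
  have : (β.norm.natAbs - 1) / 4 = 4 * (m / 4).toNat + (m % 4).toNat := by omega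
  rw [this, pow_add, pow_mul, I_pow_four, one_pow, one_mul]

theorem quarticJacobiSymbol_I_intCast {n : ℤ} (hn : Odd n) :
    quarticJacobiSymbol I (n : GaussianInt) =
      ((if n % 8 = 1 ∨ n % 8 = 7 then 1 else -1 : ℤ) : GaussianInt) := by
  obtain ⟨a, r, hr, rfl⟩ : ∃ a r : ℤ, (r = 1 ∨ r = 3 ∨ r = 5 ∨ r = 7) ∧ n = 8 * a + r :=
    ⟨n / 8, n % 8, by rw [Int.odd_iff] at hn; omega, by omega⟩
  have hnorm : ((8 * a + r : ℤ) : GaussianInt).norm =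
      4 * (4 * (4 * a ^ 2 + a * r) + (r ^ 2 - 1) / 4) + 1 := by
    rw [Zsqrtd.norm_intCast]
    rcases hr with rfl | rfl | rfl | rfl <;> norm_num <;> ring
  rw [quarticJacobiSymbol_I_of_norm hnorm, Int.mul_add_emod_self_left, Int.mul_add_emod_self_left]
  rcases hr with rfl | rfl | rfl | rfl <;> decide

theorem quarticJacobiSymbol_neg_one {β : GaussianInt} (hβ : Odd β.norm) :
    quarticJacobiSymbol (-1) β = quarticJacobiSymbol I β ^ 2 := by
  rw [← quarticJacobiSymbol_pow hβ]
  rfl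

/-- The symbol of a rational number plus `i`, in terms of the numerator and the denominator. -/
theorem quarticJacobiSymbolRat_div_one {a b n : ℤ} (hb : b ≠ 0) (hab : IsCoprime a b)
    (hn : Odd n) (hbn : IsCoprime b n) :
    quarticJacobiSymbolRat ((a : ℚ) / b) 1 n = quarticJacobiSymbol ⟨a, b⟩ n := by
  -- A reduced fraction has positive denominator, so `s` is the sign of `b`; both `s` and the
  -- denominator have trivial symbol modulo `n`.
  obtain ⟨s, hs, hnum, hden⟩ : ∃ s : ℤ, s * s = 1 ∧ ((a : ℚ) / b).num = s * a ∧
      ((((a : ℚ) / b).den : ℕ) : ℤ) = s * b := by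
    rw [Int.isCoprime_iff_gcd_eq_one] at hab
    rcases lt_or_gt_of_ne hb with h | h
    · refine ⟨-1, by norm_num, ?_⟩
      have e : (a : ℚ) / b = ((-a : ℤ) : ℚ) / ((-b : ℤ) : ℚ) := by push_cast; rw [neg_div_neg_eq]
      have hc : Nat.Coprime (-a).natAbs (-b).natAbs := by
        rw [Int.natAbs_neg, Int.natAbs_neg]; exact hab
      rw [e, Rat.num_div_eq_of_coprime (by omega) hc, Rat.den_div_eq_of_coprime (by omega) hc]
      constructor <;> ring
    · refine ⟨1, by norm_num, ?_⟩
      rw [Rat.num_div_eq_of_coprime h hab, Rat.den_div_eq_of_coprime h hab]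
      constructor <;> ring
  have hs' : IsUnit s := IsUnit.of_mul_eq_one _ hs
  have hsn : IsCoprime s n := isCoprime_one_left.of_isCoprime_of_dvd_left hs'.dvd
  have h1 : (⟨s * a, s * b⟩ : GaussianInt) = (s : GaussianInt) * ⟨a, b⟩ := by ext <;> simp
  rw [quarticJacobiSymbolRat, Rat.num_one, Rat.den_one, Nat.cast_one, mul_one, one_mul, mul_one,
    hnum, hden, h1, quarticJacobiSymbol_mul (odd_norm_intCast hn),
    quarticJacobiSymbol_intCast_intCast hn hsn.gaussianInt_intCast, one_mul]
  have h2 : ((((a : ℚ) / b).den : ℕ) : GaussianInt) = ((s * b : ℤ) : GaussianInt) := by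
    rw [← hden, Int.cast_natCast]
  rw [h2, quarticJacobiSymbol_intCast_intCast hn (hsn.mul_left hbn).gaussianInt_intCast, star_one,
    mul_one]

namespace GaussianInt

theorem exists_primary_eq {n : ℤ} (hn : Odd n) :
    ∃ e : ℤ, primary n = e * n ∧ (e = 1 ∧ n % 4 = 1 ∨ e = -1 ∧ n % 4 = 3) := by
  have : n % 4 = 1 ∨ n % 4 = 3 := by
    rw [Int.odd_iff] at hn
    omega
  rcases this with h | h
  · exact ⟨1, by rw [primary_of_mod_four_eq_one h, one_mul], Or.inl ⟨rfl, h⟩⟩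
  · exact ⟨-1, by rw [primary_of_mod_four_eq_three h, neg_one_mul], Or.inr ⟨rfl, h⟩⟩

end GaussianInt

/-- If `(-1/β)₄ = -1`, then the sign of `±n` passes through the symbol. -/
theorem quarticJacobiSymbol_primary_of_neg_one {β : GaussianInt} (hβ : Odd β.norm)
    (h : quarticJacobiSymbol (-1) β = -1) {n e : ℤ} (he : primary n = e * n)
    (he' : e = 1 ∨ e = -1) : quarticJacobiSymbol (primary n : GaussianInt) β =
      e * quarticJacobiSymbol n β := by
  rcases he' with rfl | rfl
  · rw [he, one_mul, Int.cast_one, one_mul]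
  · rw [he, Int.cast_mul, quarticJacobiSymbol_mul hβ, Int.cast_neg, Int.cast_one, h]

theorem quarticJacobiSymbol_primary_of_one {β : GaussianInt} (hβ : Odd β.norm)
    (h : quarticJacobiSymbol (-1) β = 1) {n e : ℤ} (he : primary n = e * n)
    (he' : e = 1 ∨ e = -1) : quarticJacobiSymbol (primary n : GaussianInt) β =
      quarticJacobiSymbol n β := by
  rcases he' with rfl | rfl
  · rw [he, one_mul]
  · rw [he, Int.cast_mul, quarticJacobiSymbol_mul hβ, Int.cast_neg, Int.cast_one, h, one_mul]

/-! ### The arithmetic setting and its coprimality relations. -/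

/-- The arithmetic setting `p = c² + d²`, `4p = x² + q y²` with its normalizations. -/
structure QuarticSetting (p q c d x y : ℤ) : Prop where
  mod_four : p % 4 = 1
  prime : Prime p
  q_mod : q % 8 = 3
  not_dvd : ¬ p ∣ q
  eq_cd : p = c ^ 2 + d ^ 2
  eq_xy : 4 * p = x ^ 2 + q * y ^ 2
  c_mod : c % 4 = 1
  y_mod : y % 4 = 1
  coprime : IsCoprime c (x + 2 * d)

namespace QuarticSetting

variable {p q c d x y : ℤ} (h : QuarticSetting p q c d x y)
include h

theorem odd_q : Odd q := by have := h.q_mod; rw [Int.odd_iff]; omega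
theorem odd_c : Odd c := by have := h.c_mod; rw [Int.odd_iff]; omega
theorem odd_y : Odd y := by have := h.y_mod; rw [Int.odd_iff]; omega
theorem odd_p : Odd p := by have := h.mod_four; rw [Int.odd_iff]; omega

theorem even_d : Even d := by
  have := h.odd_p
  rw [h.eq_cd, Int.odd_add] at this
  exact (Int.even_pow.1 (this.1 h.odd_c.pow)).1

theorem odd_x : Odd x := by
  have h1 : x ^ 2 = 4 * p - q * y ^ 2 := by linear_combination -h.eq_xy
  have h2 : Odd (x ^ 2) := by
    rw [h1]
    exact Even.sub_odd ⟨2 * p, by ring⟩ (h.odd_q.mul h.odd_y.pow)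
  exact (Int.odd_pow.1 h2).resolve_right two_ne_zero

theorem odd_A : Odd (x + 2 * d) := h.odd_x.add_even (even_two_mul d)

theorem isCoprime_four_p_of_odd {n : ℤ} (hn : Odd n) (hpn : ¬ p ∣ n) : IsCoprime n (4 * p) := by
  refine IsCoprime.mul_right ?_ ((Int.isCoprime_iff_gcd_eq_one.2 ?_))
  · have := (Int.isCoprime_two_right.2 hn).pow_right (n := 2)
    norm_num at this
    exact this
  · rw [Int.gcd_comm, ← Int.isCoprime_iff_gcd_eq_one]
    exact (h.prime.irreducible.coprime_iff_not_dvd).2 hpn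

/-- If `p ∣ x`, then also `p ∣ y`, so `p² ∣ 4p`, impossible for odd `p`. -/
theorem isCoprime_x_four_p : IsCoprime x (4 * p) := by
  refine h.isCoprime_four_p_of_odd h.odd_x fun hx => ?_
  have h1 : p ∣ q * y ^ 2 := by
    have : q * y ^ 2 = 4 * p - x * x := by linear_combination -h.eq_xy
    rw [this]
    exact dvd_sub (dvd_mul_left _ _) (hx.mul_right _)
  have h2 : p ∣ y := h.prime.dvd_of_dvd_pow ((h.prime.dvd_or_dvd h1).resolve_left h.not_dvd)
  obtain ⟨a, ha⟩ := hx
  obtain ⟨b, hb⟩ := h2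
  have h3 : (4 : ℤ) = p * (a ^ 2 + q * b ^ 2) := by
    refine mul_right_cancel₀ h.prime.ne_zero ?_
    rw [h.eq_xy, ha, hb]
    ring
  have h4 : IsCoprime p 4 := by
    have := (Int.isCoprime_two_right.2 h.odd_p).pow_right (n := 2)
    norm_num at this
    exact this
  exact h.prime.not_isUnit (h4.isUnit_of_dvd' dvd_rfl (Dvd.intro _ h3.symm))

theorem isCoprime_x_q_mul : IsCoprime x (q * y ^ 2) := by
  have := h.isCoprime_x_four_p
  rwa [h.eq_xy, show x ^ 2 + q * y ^ 2 = q * y ^ 2 + x * x by ring,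
    IsCoprime.add_mul_left_right_iff] at this

theorem isCoprime_q_x : IsCoprime q x := h.isCoprime_x_q_mul.of_mul_right_left.symm

theorem isCoprime_y_x : IsCoprime y x :=
  ((IsCoprime.pow_right_iff two_pos).1 h.isCoprime_x_q_mul.of_mul_right_right).symm

theorem isCoprime_y_p : IsCoprime y p := by
  have h1 : IsCoprime y (4 * p) := by
    rw [h.eq_xy, show x ^ 2 + q * y ^ 2 = x ^ 2 + y * (q * y) by ring,
      IsCoprime.add_mul_left_right_iff]
    exact h.isCoprime_y_x.pow_right
  exact h1.of_mul_right_right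

theorem isCoprime_A_two_c : IsCoprime (x + 2 * d) (2 * c) :=
  (Int.isCoprime_two_right.2 h.odd_A).mul_right h.coprime.symm

/-- Comparing the two expressions for `4p` gives `(2c)² - qy² = (x+2d)(x-2d)`. -/
theorem isCoprime_A_q_mul : IsCoprime (x + 2 * d) (q * y ^ 2) := by
  have h1 : IsCoprime (x + 2 * d) ((2 * c) ^ 2) := h.isCoprime_A_two_c.pow_right
  have h2 : (2 * c) ^ 2 = q * y ^ 2 + (x + 2 * d) * (x - 2 * d) := by
    linear_combination h.eq_xy - 4 * h.eq_cd
  rwa [h2, IsCoprime.add_mul_left_right_iff] at h1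

theorem isCoprime_q_A : IsCoprime q (x + 2 * d) := h.isCoprime_A_q_mul.of_mul_right_left.symm

theorem isCoprime_y_A : IsCoprime y (x + 2 * d) :=
  ((IsCoprime.pow_right_iff two_pos).1 h.isCoprime_A_q_mul.of_mul_right_right).symm

omit h in
theorem norm_pi : (⟨c, d⟩ : GaussianInt).norm = c ^ 2 + d ^ 2 := norm_eq_sq_add_sq _

omit h in
theorem norm_lam : (⟨x + 2 * d, -2 * c⟩ : GaussianInt).norm = (x + 2 * d) ^ 2 + (2 * c) ^ 2 := by
  rw [norm_eq_sq_add_sq]; ring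

theorem odd_norm_pi : Odd (⟨c, d⟩ : GaussianInt).norm := by
  rw [norm_pi, ← h.eq_cd]; exact h.odd_p

theorem odd_norm_lam : Odd (⟨x + 2 * d, -2 * c⟩ : GaussianInt).norm := by
  rw [norm_lam]
  exact h.odd_A.pow.add_even ((even_two_mul c).pow_of_ne_zero two_ne_zero)

/-- This form of `Nλ` shows that `q`, `x` and `y` are prime to `λ`. -/
theorem norm_lam_eq : (x + 2 * d) ^ 2 + (2 * c) ^ 2 = 2 * x * (x + 2 * d) + q * y ^ 2 := by
  linear_combination h.eq_xy - 4 * h.eq_cd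

theorem isCoprime_q_lam : IsCoprime (q : GaussianInt) ⟨x + 2 * d, -2 * c⟩ := by
  refine IsCoprime.gaussianInt_of_norm ?_
  rw [norm_lam, h.norm_lam_eq, IsCoprime.add_mul_left_right_iff]
  exact ((Int.isCoprime_two_right.2 h.odd_q).mul_right h.isCoprime_q_x).mul_right h.isCoprime_q_A

theorem isCoprime_y_lam : IsCoprime (y : GaussianInt) ⟨x + 2 * d, -2 * c⟩ := by
  refine IsCoprime.gaussianInt_of_norm ?_
  rw [norm_lam, h.norm_lam_eq, show q * y ^ 2 = y * (q * y) by ring,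
    IsCoprime.add_mul_left_right_iff]
  exact ((Int.isCoprime_two_right.2 h.odd_y).mul_right h.isCoprime_y_x).mul_right h.isCoprime_y_A

theorem isCoprime_x_lam : IsCoprime (x : GaussianInt) ⟨x + 2 * d, -2 * c⟩ := by
  refine IsCoprime.gaussianInt_of_norm ?_
  rw [norm_lam, h.norm_lam_eq, show 2 * x * (x + 2 * d) + q * y ^ 2 =
    q * y ^ 2 + x * (2 * (x + 2 * d)) by ring, IsCoprime.add_mul_left_right_iff]
  exact h.isCoprime_x_q_mul

theorem isCoprime_A_lam : IsCoprime ((x + 2 * d : ℤ) : GaussianInt) ⟨x + 2 * d, -2 * c⟩ := by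
  refine IsCoprime.gaussianInt_of_norm ?_
  rw [norm_lam, show (x + 2 * d) ^ 2 + (2 * c) ^ 2 = (2 * c) ^ 2 + (x + 2 * d) * (x + 2 * d) by ring,
    IsCoprime.add_mul_left_right_iff]
  exact h.isCoprime_A_two_c.pow_right

theorem isCoprime_B_two_c : IsCoprime (x + 2 * d + 2 * c) (2 * c) := by
  have := h.isCoprime_A_two_c
  rwa [← IsCoprime.add_mul_left_left_iff (z := 1), mul_one] at this

theorem odd_B : Odd (x + 2 * d + 2 * c) := h.odd_A.add_even (even_two_mul c)

theorem isCoprime_B_lam :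
    IsCoprime ((x + 2 * d + 2 * c : ℤ) : GaussianInt) ⟨x + 2 * d, -2 * c⟩ := by
  refine IsCoprime.gaussianInt_of_norm ?_
  rw [norm_lam, show (x + 2 * d) ^ 2 + (2 * c) ^ 2 = 2 * (2 * c) ^ 2 +
    (x + 2 * d + 2 * c) * (x + 2 * d - 2 * c) by ring, IsCoprime.add_mul_left_right_iff]
  exact (Int.isCoprime_two_right.2 h.odd_B).mul_right h.isCoprime_B_two_c.pow_right

theorem isCoprime_x_pi : IsCoprime (x : GaussianInt) ⟨c, d⟩ := by
  refine IsCoprime.gaussianInt_of_norm ?_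
  rw [norm_pi, ← h.eq_cd]
  exact h.isCoprime_x_four_p.of_mul_right_right

theorem isCoprime_y_pi : IsCoprime (y : GaussianInt) ⟨c, d⟩ := by
  refine IsCoprime.gaussianInt_of_norm ?_
  rw [norm_pi, ← h.eq_cd]
  exact h.isCoprime_y_p

/-! ### Symbols modulo `λ = (x + 2d) - 2ci`. -/

omit h in
theorem even_im_lam : Even (⟨x + 2 * d, -2 * c⟩ : GaussianInt).im := ⟨-c, by ring⟩

theorem symbol_lam_q : quarticJacobiSymbol ⟨x + 2 * d, -2 * c⟩ q =
    quarticJacobiSymbol ((-q : ℤ) : GaussianInt) ⟨x + 2 * d, -2 * c⟩ := by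
  rw [← quarticJacobiSymbol_reciprocity h.odd_q h.odd_norm_lam even_im_lam h.isCoprime_q_lam,
    primary_of_mod_four_eq_three (by have := h.q_mod; omega)]

/-- The numerator `2c + (x+2d)i` is `iλ`, and `(i/q)₄ = -1` because `q ≡ 3 (mod 8)`. -/
theorem symbolRat_eq : quarticJacobiSymbolRat ((2 * c : ℚ) / (x + 2 * d : ℚ)) 1 q =
    -quarticJacobiSymbol ⟨x + 2 * d, -2 * c⟩ q := by
  have hA0 : x + 2 * d ≠ 0 := by
    intro h0
    have := h.odd_A
    rw [h0] at this
    simp at this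
  have h1 := quarticJacobiSymbolRat_div_one hA0 h.isCoprime_A_two_c.symm h.odd_q
    h.isCoprime_q_A.symm
  push_cast at h1
  rw [h1, show (⟨2 * c, x + 2 * d⟩ : GaussianInt) = I * ⟨x + 2 * d, -2 * c⟩ by ext <;> simp,
    quarticJacobiSymbol_mul (odd_norm_intCast h.odd_q), quarticJacobiSymbol_I_intCast h.odd_q,
    if_neg (by have := h.q_mod; omega)]
  simp

/-- Reciprocity is applied twice around `λ² ≡ -4(x+2d) · iπ (mod y)`, whose rational factor has
trivial symbol. -/
theorem symbol_y_lam_sq : quarticJacobiSymbol (y : GaussianInt) ⟨x + 2 * d, -2 * c⟩ ^ 2 =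
    quarticJacobiSymbol I (y : GaussianInt) * quarticJacobiSymbol (y : GaussianInt) ⟨c, d⟩ := by
  have hodd := odd_norm_intCast h.odd_y
  have h1 := quarticJacobiSymbol_reciprocity h.odd_y h.odd_norm_lam even_im_lam h.isCoprime_y_lam
  have h2 := quarticJacobiSymbol_reciprocity h.odd_y h.odd_norm_pi h.even_d h.isCoprime_y_pi
  rw [primary_of_mod_four_eq_one h.y_mod] at h1 h2
  rw [h1, h2, ← quarticJacobiSymbol_pow hodd]
  have h3 : (y : GaussianInt) ∣ ⟨x + 2 * d, -2 * c⟩ ^ 2 -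
      ((-(2 * 2 * (x + 2 * d)) : ℤ) : GaussianInt) * (I * ⟨c, d⟩) := by
    rw [Zsqrtd.intCast_dvd]
    constructor
    · refine ⟨-(q * y), ?_⟩
      simp [sq]
      linear_combination 4 * h.eq_cd - h.eq_xy
    · refine ⟨0, ?_⟩
      simp [sq]
      ring
  have h2y : IsCoprime (2 : ℤ) y := Int.isCoprime_two_left.2 h.odd_y
  rw [quarticJacobiSymbol_congr hodd h3, quarticJacobiSymbol_mul hodd, quarticJacobiSymbol_mul hodd,
    quarticJacobiSymbol_intCast_intCast h.odd_y
      (((h2y.mul_left h2y).mul_left h.isCoprime_y_A.symm).neg_left).gaussianInt_intCast, one_mul]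

/-- The same argument with `λ ≡ -2 · iπ (mod x)`. -/
theorem symbol_primary_x_lam :
    quarticJacobiSymbol (primary x : GaussianInt) ⟨x + 2 * d, -2 * c⟩ =
      quarticJacobiSymbol I (x : GaussianInt) *
        quarticJacobiSymbol (primary x : GaussianInt) ⟨c, d⟩ := by
  have hodd := odd_norm_intCast h.odd_x
  rw [quarticJacobiSymbol_reciprocity h.odd_x h.odd_norm_lam even_im_lam h.isCoprime_x_lam,
    quarticJacobiSymbol_reciprocity h.odd_x h.odd_norm_pi h.even_d h.isCoprime_x_pi]
  have h3 : (x : GaussianInt) ∣ ⟨x + 2 * d, -2 * c⟩ - ((-2 : ℤ) : GaussianInt) * (I * ⟨c, d⟩) := by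
    refine ⟨1, ?_⟩
    ext <;> simp
  rw [quarticJacobiSymbol_congr hodd h3, quarticJacobiSymbol_mul hodd, quarticJacobiSymbol_mul hodd,
    quarticJacobiSymbol_intCast_intCast h.odd_x
      (Int.isCoprime_two_left.2 h.odd_x).neg_left.gaussianInt_intCast, one_mul]

theorem symbol_primary_A_lam :
    quarticJacobiSymbol (primary (x + 2 * d) : GaussianInt) ⟨x + 2 * d, -2 * c⟩ =
      quarticJacobiSymbol I ((x + 2 * d : ℤ) : GaussianInt) := by
  have hodd := odd_norm_intCast h.odd_A
  rw [quarticJacobiSymbol_reciprocity h.odd_A h.odd_norm_lam even_im_lam h.isCoprime_A_lam]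
  have h3 : ((x + 2 * d : ℤ) : GaussianInt) ∣
      ⟨x + 2 * d, -2 * c⟩ - ((-(2 * c) : ℤ) : GaussianInt) * I := by
    refine ⟨1, ?_⟩
    ext <;> simp
  rw [quarticJacobiSymbol_congr hodd h3, quarticJacobiSymbol_mul hodd,
    quarticJacobiSymbol_intCast_intCast h.odd_A
      h.isCoprime_A_two_c.symm.neg_left.gaussianInt_intCast, one_mul]

/-- With `B = x + 2d + 2c`, one has `λ² ≡ 2(2c)² i (mod B)`. The square makes the sign of `B`
harmless when passing to its primary form. -/
theorem symbol_B_lam_sq :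
    quarticJacobiSymbol ((x + 2 * d + 2 * c : ℤ) : GaussianInt) ⟨x + 2 * d, -2 * c⟩ ^ 2 =
      quarticJacobiSymbol I ((x + 2 * d + 2 * c : ℤ) : GaussianInt) := by
  have hodd := odd_norm_intCast h.odd_B
  obtain ⟨e, he, he'⟩ := exists_primary_eq h.odd_B
  have he2 : e ^ 2 = 1 := by rcases he' with ⟨rfl, -⟩ | ⟨rfl, -⟩ <;> norm_num
  have h1 : ((x + 2 * d + 2 * c : ℤ) : GaussianInt) ^ 2 =
      (primary (x + 2 * d + 2 * c) : GaussianInt) ^ 2 := by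
    rw [he, ← Int.cast_pow, ← Int.cast_pow, mul_pow, he2, one_mul]
  rw [← quarticJacobiSymbol_pow h.odd_norm_lam, h1, quarticJacobiSymbol_pow h.odd_norm_lam,
    quarticJacobiSymbol_reciprocity h.odd_B h.odd_norm_lam even_im_lam h.isCoprime_B_lam,
    ← quarticJacobiSymbol_pow hodd]
  have h3 : ((x + 2 * d + 2 * c : ℤ) : GaussianInt) ∣
      ⟨x + 2 * d, -2 * c⟩ ^ 2 - ((2 * (2 * c) ^ 2 : ℤ) : GaussianInt) * I := by
    refine ⟨⟨x + 2 * d - 2 * c, -4 * c⟩, ?_⟩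
    ext <;> simp [sq] <;> ring
  rw [quarticJacobiSymbol_congr hodd h3, quarticJacobiSymbol_mul hodd,
    quarticJacobiSymbol_intCast_intCast h.odd_B (((Int.isCoprime_two_left.2 h.odd_B).mul_left
      h.isCoprime_B_two_c.symm.pow_left)).gaussianInt_intCast, one_mul]

/-- With `A = x + 2d` and `B = A + 2c`, one has `-qy² ≡ 2xA` and `2c ≡ -iA (mod λ)`. Hence `B ≡
(1-i)A` and `iB² ≡ 2A²`, so `-qy²A ≡ 2xA² ≡ iB²x`. -/
theorem symbol_relation :
    quarticJacobiSymbol ((-q : ℤ) : GaussianInt) ⟨x + 2 * d, -2 * c⟩ *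
      quarticJacobiSymbol (y : GaussianInt) ⟨x + 2 * d, -2 * c⟩ ^ 2 *
      quarticJacobiSymbol ((x + 2 * d : ℤ) : GaussianInt) ⟨x + 2 * d, -2 * c⟩ =
    quarticJacobiSymbol I ⟨x + 2 * d, -2 * c⟩ *
      quarticJacobiSymbol ((x + 2 * d + 2 * c : ℤ) : GaussianInt) ⟨x + 2 * d, -2 * c⟩ ^ 2 *
      quarticJacobiSymbol (x : GaussianInt) ⟨x + 2 * d, -2 * c⟩ := by
  have hodd := h.odd_norm_lam
  have h1 : (⟨x + 2 * d, -2 * c⟩ : GaussianInt) ∣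
      ((-q : ℤ) : GaussianInt) * (y : GaussianInt) ^ 2 * ((x + 2 * d : ℤ) : GaussianInt) -
      I * ((x + 2 * d + 2 * c : ℤ) : GaussianInt) ^ 2 * (x : GaussianInt) := by
    refine ⟨(x : GaussianInt) * ⟨2 * (x + 2 * d) + 2 * c, -(x + 2 * d)⟩ -
      ((x + 2 * d : ℤ) : GaussianInt) * ⟨x + 2 * d, 2 * c⟩, ?_⟩
    ext
    · simp [sq]
      linear_combination (-(x + 2 * d)) * (4 * h.eq_cd - h.eq_xy)
    · simp [sq]
      ring
  simpa only [quarticJacobiSymbol_mul hodd, quarticJacobiSymbol_pow hodd]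
    using quarticJacobiSymbol_congr hodd h1

/-- As `c` is odd, `(2c)² ≡ 4 (mod 16)`, so the exponent `(N-1)/4` for `λ` exceeds that for `x + 2d`
by 1 modulo 4. -/
theorem symbol_I_lam : quarticJacobiSymbol I ⟨x + 2 * d, -2 * c⟩ =
    I * quarticJacobiSymbol I ((x + 2 * d : ℤ) : GaussianInt) := by
  obtain ⟨a, ha⟩ := h.odd_A
  obtain ⟨b, hb⟩ : ∃ b, c = 4 * b + 1 := ⟨c / 4, by have := h.c_mod; omega⟩
  have h1 : (⟨x + 2 * d, -2 * c⟩ : GaussianInt).norm =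
      4 * (4 * (4 * b ^ 2 + 2 * b) + (a * (a + 1) + 1)) + 1 := by
    rw [norm_lam, ha, hb]; ring
  have h2 : ((x + 2 * d : ℤ) : GaussianInt).norm = 4 * (a * (a + 1)) + 1 := by
    rw [Zsqrtd.norm_intCast, ha]; ring
  rw [quarticJacobiSymbol_I_of_norm h1, quarticJacobiSymbol_I_of_norm h2,
    Int.mul_add_emod_self_left]
  obtain ⟨m, hm⟩ := Int.even_mul_succ_self a
  rw [hm]
  obtain ⟨n, rfl | rfl⟩ := Int.even_or_odd' m
  · rw [show (2 * n + 2 * n + 1) % 4 = 1 by omega, show (2 * n + 2 * n) % 4 = 0 by omega]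
    decide
  · rw [show (2 * n + 1 + (2 * n + 1) + 1) % 4 = 3 by omega,
      show (2 * n + 1 + (2 * n + 1)) % 4 = 2 by omega]
    decide

theorem symbol_neg_one_lam : quarticJacobiSymbol (-1) ⟨x + 2 * d, -2 * c⟩ = -1 := by
  rw [quarticJacobiSymbol_neg_one h.odd_norm_lam, h.symbol_I_lam,
    quarticJacobiSymbol_I_intCast h.odd_A]
  split_ifs <;> decide

theorem symbol_neg_one_pi : quarticJacobiSymbol (-1) ⟨c, d⟩ = if p % 8 = 1 then 1 else -1 := by
  have hp := h.mod_four
  obtain ⟨m, hm⟩ : ∃ m, p = 4 * m + 1 := ⟨p / 4, by omega⟩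
  have h1 : (⟨c, d⟩ : GaussianInt).norm = 4 * m + 1 := by rw [norm_pi, ← h.eq_cd, hm]
  rw [quarticJacobiSymbol_neg_one h.odd_norm_pi, quarticJacobiSymbol_I_of_norm h1]
  have h2 : m % 4 = 0 ∨ m % 4 = 1 ∨ m % 4 = 2 ∨ m % 4 = 3 := by omega
  rcases h2 with h2 | h2 | h2 | h2 <;> rw [h2]
  · rw [if_pos (by omega)]; decide
  · rw [if_neg (by omega)]; decide
  · rw [if_pos (by omega)]; decide
  · rw [if_neg (by omega)]; decide

/-- The value of the symbol of `q` in terms of the symbols of `x` and `y` modulo `c + d i`, with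
all signs explicit. -/
theorem symbol_relation_explicit {e f : ℤ} (he : primary x = e * x) (he' : e = 1 ∨ e = -1)
    (hf : primary (x + 2 * d) = f * (x + 2 * d)) (hf' : f = 1 ∨ f = -1) :
    quarticJacobiSymbol ⟨x + 2 * d, -2 * c⟩ q * quarticJacobiSymbol I (y : GaussianInt) *
      quarticJacobiSymbol (y : GaussianInt) ⟨c, d⟩ * f =
    I * quarticJacobiSymbol I ((x + 2 * d + 2 * c : ℤ) : GaussianInt) * e *
      quarticJacobiSymbol I (x : GaussianInt) *
        quarticJacobiSymbol (primary x : GaussianInt) ⟨c, d⟩ := by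
  have h1 := h.symbol_relation
  have h2 := quarticJacobiSymbol_primary_of_neg_one h.odd_norm_lam h.symbol_neg_one_lam he he'
  have h3 := quarticJacobiSymbol_primary_of_neg_one h.odd_norm_lam h.symbol_neg_one_lam hf hf'
  rw [h.symbol_primary_x_lam] at h2
  rw [h.symbol_primary_A_lam] at h3
  rw [h.symbol_y_lam_sq, h.symbol_B_lam_sq, h.symbol_I_lam, h3, ← h.symbol_lam_q] at h1
  have he2 : (e : GaussianInt) * e = 1 := by rcases he' with rfl | rfl <;> norm_num
  have hA4 := quarticJacobiSymbol_pow_four h.odd_norm_lam h.isCoprime_A_lam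
  set A := quarticJacobiSymbol ((x + 2 * d : ℤ) : GaussianInt) ⟨x + 2 * d, -2 * c⟩
  have hA0 : A ≠ 0 := by
    intro h0
    rw [h0] at hA4
    norm_num at hA4
  have hf2 : (f : GaussianInt) * f = 1 := by rcases hf' with rfl | rfl <;> norm_num
  -- With `A = x + 2d`, `(i/λ)₄ = i (i/A)₄` and `(i/A)₄ = f (A/λ)₄`, so `(A/λ)₄` occurs on both
  -- sides of the relation.
  refine mul_right_cancel₀ hA0 ?_
  linear_combination (f : GaussianInt) * h1 -
    I * A * quarticJacobiSymbol I ((x + 2 * d + 2 * c : ℤ) : GaussianInt) * e * h2 +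
    I * A * quarticJacobiSymbol I ((x + 2 * d + 2 * c : ℤ) : GaussianInt) *
      quarticJacobiSymbol (x : GaussianInt) ⟨x + 2 * d, -2 * c⟩ * (hf2 - he2)

/-! ### Determination of the signs modulo 8 and 16. -/

theorem sq_mod_sixteen : x ^ 2 % 16 = (8 * ((q - 3) / 8) + 8 * (y / 4) + 1) % 16 := by
  have hp := h.mod_four
  have hq := h.q_mod
  have hy := h.y_mod
  obtain ⟨m, hm⟩ : ∃ m, q = 8 * m + 3 := ⟨q / 8, by omega⟩
  obtain ⟨t, ht⟩ : ∃ t, y = 4 * t + 1 := ⟨y / 4, by omega⟩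
  obtain ⟨r, hr⟩ : ∃ r, p = 4 * r + 1 := ⟨p / 4, by omega⟩
  have h1 : x ^ 2 = 16 * (r - 8 * m * t ^ 2 - 4 * m * t - 3 * t ^ 2 - 2 * t - m) +
      (8 * m + 8 * t + 1) := by
    have := h.eq_xy
    rw [hm, ht, hr] at this
    linear_combination -this
  rw [h1, hm, ht]
  omega

theorem d_mod : p % 8 = 1 ∧ d % 4 = 0 ∨ p % 8 = 5 ∧ d % 4 = 2 := by
  obtain ⟨b, hb⟩ : ∃ b, c = 4 * b + 1 := ⟨c / 4, by have := h.c_mod; omega⟩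
  obtain ⟨a, ha⟩ := h.even_d
  obtain ⟨m, hm | hm⟩ := Int.even_or_odd' a
  · left
    refine ⟨?_, by omega⟩
    have : p = 8 * (2 * b ^ 2 + b + 2 * m ^ 2) + 1 := by rw [h.eq_cd, hb, ha, hm]; ring
    omega
  · right
    refine ⟨?_, by omega⟩
    have : p = 8 * (2 * b ^ 2 + b + 2 * m ^ 2 + 2 * m) + 5 := by rw [h.eq_cd, hb, ha, hm]; ring
    omega

theorem sq_mod_sixteen_cases : x ^ 2 % 16 = 1 ∧ (x % 8 = 1 ∨ x % 8 = 7) ∨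
    x ^ 2 % 16 = 9 ∧ (x % 8 = 3 ∨ x % 8 = 5) := by
  have h16 : x ^ 2 % 16 = (x % 8) ^ 2 % 16 := by
    conv_lhs => rw [← Int.mul_ediv_add_emod x 8]
    rw [show (8 * (x / 8) + x % 8) ^ 2 = (x % 8) ^ 2 + 16 * (4 * (x / 8) ^ 2 + x / 8 * (x % 8)) by
      ring, Int.add_mul_emod_self_left]
  have hx := Int.odd_iff.1 h.odd_x
  have : x % 8 = 1 ∨ x % 8 = 3 ∨ x % 8 = 5 ∨ x % 8 = 7 := by omega
  rw [h16]
  rcases this with h | h | h | h <;> rw [h] <;> norm_num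

theorem exists_symbol_x_pi_of_mod_eight_eq_one (hp : p % 8 = 1) :
    ∃ σ : ℤ, (σ = 1 ∧ Even (x / 4 + (q - 3) / 8) ∨ σ = -1 ∧ Odd (x / 4 + (q - 3) / 8)) ∧
      quarticJacobiSymbol (x : GaussianInt) ⟨c, d⟩ * I =
        σ * -quarticJacobiSymbol ⟨x + 2 * d, -2 * c⟩ q *
          quarticJacobiSymbol (y : GaussianInt) ⟨c, d⟩ := by
  obtain ⟨e, he, he'⟩ := exists_primary_eq h.odd_x
  obtain ⟨f, hf, hf'⟩ := exists_primary_eq h.odd_A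
  have h1 := h.symbol_relation_explicit he (he'.imp And.left And.left) hf
    (hf'.imp And.left And.left)
  have h2 := h.symbol_neg_one_pi
  rw [if_pos hp] at h2
  rw [quarticJacobiSymbol_primary_of_one h.odd_norm_pi h2 he (he'.imp And.left And.left),
    quarticJacobiSymbol_I_intCast h.odd_B, quarticJacobiSymbol_I_intCast h.odd_x,
    quarticJacobiSymbol_I_intCast h.odd_y] at h1
  have hd : d % 4 = 0 := by have := h.d_mod; omega
  have hc := h.c_mod
  have hy := h.y_mod
  have hsq := h.sq_mod_sixteen
  have hx8 := h.sq_mod_sixteen_cases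
  -- Since `d` is even, `x + 2d ≡ x (mod 4)`.
  have hef : f = e := by omega
  rw [hef] at h1
  have hB : (x + 2 * d + 2 * c) % 8 = (x + 2) % 8 := by omega
  rw [hB] at h1
  generalize hsx : (if x % 8 = 1 ∨ x % 8 = 7 then 1 else -1 : ℤ) = sx at h1
  generalize hsy : (if y % 8 = 1 ∨ y % 8 = 7 then 1 else -1 : ℤ) = sy at h1
  generalize hsB : (if (x + 2) % 8 = 1 ∨ (x + 2) % 8 = 7 then 1 else -1 : ℤ) = sB at h1
  have e1 : sx = 1 ∨ sx = -1 := by omega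
  have e2 : sy = 1 ∨ sy = -1 := by omega
  have e3 : sB = 1 ∨ sB = -1 := by omega
  have e4 : e = 1 ∨ e = -1 := by omega
  -- Here `-sB = (-1)^[x/4]`, and `sx * sy = (-1)^((q-3)/8)` by the congruence for `x²` modulo 16.
  refine ⟨-(sx * sy * sB), ?_, ?_⟩
  · rw [Int.even_iff, Int.odd_iff]
    rcases e1 with rfl | rfl <;> rcases e2 with rfl | rfl <;> rcases e3 with rfl | rfl <;>
      norm_num <;> omega
  · rcases e1 with rfl | rfl <;> rcases e2 with rfl | rfl <;> rcases e3 with rfl | rfl <;>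
      rcases e4 with rfl | rfl <;> push_cast at h1 ⊢ <;>
      first | linear_combination h1 | linear_combination -h1

theorem exists_symbol_x_pi_of_mod_eight_eq_five (hp : p % 8 = 5) :
    ∃ σ : ℤ, (σ = 1 ∧ Even ((x ^ 2 - 1) / 8 + (q - 3) / 8) ∨
        σ = -1 ∧ Odd ((x ^ 2 - 1) / 8 + (q - 3) / 8)) ∧
      quarticJacobiSymbol (x : GaussianInt) ⟨c, d⟩ * I =
        -(σ * -quarticJacobiSymbol ⟨x + 2 * d, -2 * c⟩ q *
          quarticJacobiSymbol (y : GaussianInt) ⟨c, d⟩) := by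
  obtain ⟨e, he, he'⟩ := exists_primary_eq h.odd_x
  obtain ⟨f, hf, hf'⟩ := exists_primary_eq h.odd_A
  have h1 := h.symbol_relation_explicit he (he'.imp And.left And.left) hf
    (hf'.imp And.left And.left)
  have h2 := h.symbol_neg_one_pi
  rw [if_neg (by omega)] at h2
  rw [quarticJacobiSymbol_primary_of_neg_one h.odd_norm_pi h2 he (he'.imp And.left And.left),
    quarticJacobiSymbol_I_intCast h.odd_B, quarticJacobiSymbol_I_intCast h.odd_x,
    quarticJacobiSymbol_I_intCast h.odd_y] at h1
  have hd : d % 4 = 2 := by have := h.d_mod; omega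
  have hc := h.c_mod
  have hy := h.y_mod
  have hsq := h.sq_mod_sixteen
  have hx8 := h.sq_mod_sixteen_cases
  have hef : f = e := by omega
  rw [hef] at h1
  have hB : (x + 2 * d + 2 * c) % 8 = (x + 6) % 8 := by omega
  rw [hB] at h1
  generalize hsx : (if x % 8 = 1 ∨ x % 8 = 7 then 1 else -1 : ℤ) = sx at h1
  generalize hsy : (if y % 8 = 1 ∨ y % 8 = 7 then 1 else -1 : ℤ) = sy at h1
  generalize hsB : (if (x + 6) % 8 = 1 ∨ (x + 6) % 8 = 7 then 1 else -1 : ℤ) = sB at h1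
  have e1 : sx = 1 ∨ sx = -1 := by omega
  have e2 : sy = 1 ∨ sy = -1 := by omega
  have e3 : sB = 1 ∨ sB = -1 := by omega
  have e4 : e = 1 ∨ e = -1 := by omega
  -- Here `sB * e = (-1)^((x²-1)/8)` and again `sx * sy = (-1)^((q-3)/8)`. The factor `e` survives
  -- because `(-1/π)₄ = -1`.
  refine ⟨sx * sy * sB * e, ?_, ?_⟩
  · rw [Int.even_iff, Int.odd_iff]
    generalize x ^ 2 = w at *
    rcases e1 with rfl | rfl <;> rcases e2 with rfl | rfl <;> rcases e3 with rfl | rfl <;>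
      rcases e4 with rfl | rfl <;> norm_num <;> omega
  · rcases e1 with rfl | rfl <;> rcases e2 with rfl | rfl <;> rcases e3 with rfl | rfl <;>
      rcases e4 with rfl | rfl <;> push_cast at h1 ⊢ <;>
      first | linear_combination h1 | linear_combination -h1

end QuarticSetting

/-! ### Transfer to `ZMod p` and the theorem. -/

namespace GaussianInt

/-- The exponent may be negative, so it is reduced modulo 4; injectivity of `ℤ[i] → ℂ` then
identifies `s` as a power of `i`, which any ring map preserves. -/
theorem map_eq_zpow_of_toComplex_eq {K : Type*} [Field K] (φ : GaussianInt →+* K) {s : GaussianInt}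
    {k : ℤ} (h : toComplex s = Complex.I ^ k) : φ s = φ I ^ k := by
  have hK : φ I ^ 4 = 1 := by rw [← map_pow, I_pow_four, map_one]
  have hI : toComplex I = Complex.I := by simp [toComplex_def]
  have hI0 : φ I ≠ 0 := by
    intro h0
    rw [h0] at hK
    norm_num at hK
  have e : k = 4 * (k / 4) + ((k % 4).toNat : ℕ) := by omega
  have red {L : Type _} [Field L] {z : L} (hz : z ≠ 0) (hz4 : z ^ 4 = 1) :
      z ^ k = z ^ (k % 4).toNat := by
    conv_lhs => rw [e]
    rw [zpow_add₀ hz, zpow_mul, zpow_natCast]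
    have : z ^ (4 : ℤ) = 1 := by exact_mod_cast hz4
    rw [this, one_zpow, one_mul]
  have h1 : s = I ^ (k % 4).toNat := by
    apply toComplex_injective
    rw [h, map_pow, hI]
    conv_lhs => rw [e]
    rw [zpow_add₀ Complex.I_ne_zero, zpow_mul, zpow_natCast]
    have : Complex.I ^ (4 : ℤ) = 1 := by exact_mod_cast Complex.I_pow_four
    rw [this, one_zpow, one_mul]
  rw [h1, map_pow, red hI0 hK]

end GaussianInt

theorem neg_one_zpow_eq_intCast {K : Type*} [Field K] {n σ : ℤ}
    (h : σ = 1 ∧ Even n ∨ σ = -1 ∧ Odd n) : (-1 : K) ^ n = σ := by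
  rcases h with ⟨rfl, hn⟩ | ⟨rfl, hn⟩
  · rw [hn.neg_one_zpow, Int.cast_one]
  · rw [hn.neg_one_zpow, Int.cast_neg, Int.cast_one]

theorem theorem3p1 (p : ℕ) [Fact p.Prime] (hp : p % 4 = 1) (q : ℤ) (hq : q ≡ 3 [ZMOD 8])
    (hpq : ¬ (p : ℤ) ∣ q) (c d x y : ℤ)
    (hcd : (p : ℤ) = c ^ 2 + d ^ 2) (hxy : 4 * (p : ℤ) = x ^ 2 + q * y ^ 2)
    (hc : c ≡ 1 [ZMOD 4]) (hy : y ≡ 1 [ZMOD 4])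
    (hgcd : Int.gcd c (x + 2 * d) = 1) (k : ℤ)
    (hk : GaussianInt.toComplex
        (quarticJacobiSymbolRat ((2 * c : ℚ) / (x + 2 * d : ℚ)) 1 (q : GaussianInt)) =
      Complex.I ^ k) :
    (p % 8 = 1 →
      (-(q : ZMod p)) ^ (p / 8) =
        (-1 : ZMod p) ^ (x / 4 + (q - 3) / 8) * ((d : ZMod p) / (c : ZMod p)) ^ (k - 1)) ∧
    (p % 8 = 5 →
      (-(q : ZMod p)) ^ (p / 8) =
        -((-1 : ZMod p) ^ ((x ^ 2 - 1) / 8 + (q - 3) / 8)) *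
          ((d : ZMod p) / (c : ZMod p)) ^ (k - 1) * ((y : ZMod p) / (x : ZMod p))) := by
  have hprime : p.Prime := Fact.out
  have h : QuarticSetting p q c d x y :=
    { mod_four := by exact_mod_cast hp
      prime := Nat.prime_iff_prime_int.1 hprime
      q_mod := hq
      not_dvd := hpq
      eq_cd := hcd
      eq_xy := hxy
      c_mod := hc
      y_mod := hy
      coprime := Int.isCoprime_iff_gcd_eq_one.2 hgcd }
  have ne_zero {n : ℤ} (hn : IsCoprime n (p : ℤ)) : (n : ZMod p) ≠ 0 := by
    intro h0
    rw [ZMod.intCast_zmod_eq_zero_iff_dvd] at h0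
    exact h.prime.not_isUnit (hn.isUnit_of_dvd' h0 dvd_rfl)
  have hx0 : (x : ZMod p) ≠ 0 := ne_zero h.isCoprime_x_four_p.of_mul_right_right
  have hy0 : (y : ZMod p) ≠ 0 := ne_zero h.isCoprime_y_p
  have hcd0 : (c : ZMod p) ^ 2 + (d : ZMod p) ^ 2 = 0 := by
    have := congrArg (Int.cast : ℤ → ZMod p) hcd
    push_cast at this
    rw [← this, ZMod.natCast_self]
  have hc0 : (c : ZMod p) ≠ 0 := by
    intro h0
    have hd0 : (d : ZMod p) = 0 := by
      rw [h0] at hcd0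
      simpa using hcd0
    rw [ZMod.intCast_zmod_eq_zero_iff_dvd] at h0 hd0
    obtain ⟨a, ha⟩ := h0
    obtain ⟨b, hb⟩ := hd0
    have h1 : (1 : ℤ) = p * (a ^ 2 + b ^ 2) := by
      refine mul_left_cancel₀ h.prime.ne_zero ?_
      conv_lhs => rw [mul_one, hcd, ha, hb]
      ring
    exact h.prime.not_dvd_one (Dvd.intro _ h1.symm)
  have hxy0 : -(q : ZMod p) = ((x : ZMod p) / y) ^ 2 := by
    have := congrArg (Int.cast : ℤ → ZMod p) hxy
    push_cast at this
    rw [ZMod.natCast_self, mul_zero] at this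
    field_simp
    linear_combination this
  set r : ZMod p := d / c with hr
  have hr2 : r * r = ((-1 : ℤ) : ZMod p) := by
    rw [hr]
    push_cast
    field_simp
    linear_combination hcd0
  have hr0 : r ≠ 0 := by
    intro h0
    rw [h0] at hr2
    simp at hr2
  -- This is reduction modulo `c + di`: from `c + di = 0` and `c² + d² = 0` one gets `i = -c/d =
  -- d/c`.
  let φ : GaussianInt →+* ZMod p := Zsqrtd.lift ⟨r, hr2⟩
  have hφI : φ I = r := by simp [φ]
  have hφπ : φ ⟨c, d⟩ = 0 := by
    have : φ ⟨c, d⟩ = c + d * r := by simp [φ]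
    rw [this, hr]
    field_simp
    linear_combination hcd0
  have hnorm : (⟨c, d⟩ : GaussianInt).norm = p := by rw [QuarticSetting.norm_pi, hcd]
  have hπ : Prime (⟨c, d⟩ : GaussianInt) := prime_of_prime_norm hprime hnorm
  have hsymbol {n : ℤ} (hn : IsCoprime (n : GaussianInt) ⟨c, d⟩) :
      φ (quarticJacobiSymbol (n : GaussianInt) ⟨c, d⟩) = (n : ZMod p) ^ ((p - 1) / 4) := by
    have h1 := (quarticResidueSymbol_spec hπ h.odd_norm_pi (not_dvd_of_isCoprime hπ hn)).2
    have h2 := map_dvd φ h1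
    rw [hφπ, zero_dvd_iff, map_sub, map_pow, map_intCast, hnorm, Int.natAbs_natCast,
      sub_eq_zero] at h2
    rw [quarticJacobiSymbol_prime hπ, h2]
  have hJ := map_eq_zpow_of_toComplex_eq φ hk
  rw [h.symbolRat_eq, hφI] at hJ
  constructor
  · intro hp8
    obtain ⟨σ, hσ, hrel⟩ := h.exists_symbol_x_pi_of_mod_eight_eq_one (by exact_mod_cast hp8)
    have h1 := congrArg φ hrel
    rw [map_mul, map_mul, map_mul, hsymbol h.isCoprime_x_pi, hsymbol h.isCoprime_y_pi, hφI, hJ,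
      map_intCast] at h1
    rw [neg_one_zpow_eq_intCast hσ, hxy0, ← pow_mul, show 2 * (p / 8) = (p - 1) / 4 by omega,
      div_pow, zpow_sub_one₀ hr0, div_eq_iff (pow_ne_zero _ hy0)]
    field_simp
    linear_combination h1
  · intro hp8
    obtain ⟨σ, hσ, hrel⟩ := h.exists_symbol_x_pi_of_mod_eight_eq_five (by exact_mod_cast hp8)
    have h1 := congrArg φ hrel
    rw [map_mul, map_neg, map_mul, map_mul, hsymbol h.isCoprime_x_pi, hsymbol h.isCoprime_y_pi, hφI,
      hJ, map_intCast] at h1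
    -- For `p ≡ 5 (mod 8)`, `(x/y)^(2[p/8])` falls one power short of the quartic exponent; this is
    -- the source of the factor `y/x`.
    have h2 : (p - 1) / 4 = 2 * (p / 8) + 1 := by omega
    rw [neg_one_zpow_eq_intCast hσ, hxy0, ← pow_mul, zpow_sub_one₀ hr0]
    rw [h2, pow_succ, pow_succ] at h1
    rw [div_pow, div_eq_iff (pow_ne_zero _ hy0)]
    field_simp
    linear_combination h1
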